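/- Let $\Bbbk$ be a field of characteristic zero and let $A=A^{\bullet,\bullet}$ be a cosimplicial unital non-negatively graded commutative differential graded $\Bbbk$-algebra (first index cosimplicial, second index differential degree). Let $N(A)^{p,q}\subseteq A^{p,q}$ be the common kernel of the codegeneracies and let $\operatorname{Tot}_N(A)$ be the associated total complex, $\operatorname{Tot}^m_N(A)=\bigoplus_{p+q=m}N(A)^{p,q}$. Let $\Omega(n)$ be the algebra of polynomial differential forms on the $n$-simplex, $NC_n$ the normalized cochains of the $n$-simplex, and $E_n\colon NC_n\to\Omega(n)$, $\int_n\colon\Omega(n)\to NC_n$, $s_n$ the Dupont contraction (Whitney forms, integration over faces, and the homotopy, normalized by $d s_n+s_n d=E_n\int_n-\mathrm{Id}$). Let $m_l$, $l\ge 2$, be the operations of the $C_\infty$-structure on $\operatorname{Tot}_N(A)\cong\int^{[n]}NC_n\otimes A^{n,\bullet}$ transferred from the algebras $\Omega(n)\otimes A^{n,\bullet}$ along $(E_n\otimes \mathrm{Id},\int_n\otimes\mathrm{Id},s_n\otimes\mathrm{Id})$, with the signs $$m_l=\textstyle\int\circ P_l\circ E^{\otimes l},\qquad P_l=\sum_{a+b=l,\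 a,b\ge1}(-1)^{a(b+1)}\,\mu\circ(sP_a\otimes sP_b),\qquad sP_1:=\mathrm{Id},$$ where $\mu$ is the product and the Koszul rule is used (equivalently, the maps $s\circ m_l\circ(s^{-1})^{\otimes l}$, with $s$ here the suspension, form a square-zero coderivation). Let $\tilde\partial=d^0-d^1\colon A^{0,\bullet}\to A^{1,\bullet}$ be the difference of the two coface maps, and let $B_n$ be the Bernoulli numbers ($B_2=\tfrac16$). The products $b_1\cdots\widehat{b_i}\cdots b_l\,\tilde\partial c_i$ below are taken in the algebra $A^{1,\bullet}$, and elements of $A^{0,\bullet}$ and of $A^{1,\bullet}$ are regarded as elements of the total complex of cosimplicial degree $0$ and $1$. Let $l>2$. Let $a_1,\dots,a_l\in\operatorname{Tot}^1_N(A)$ and let $b_i\in A^{1,0}$, $c_i\in A^{0,1}$ be such that $a_i=b_i+c_i$ for $i=1,\dots,l$. 1. $$m_l(a_1,\dots,a_l)=\sum_{i=1}^{l}(-1)^{l-1}(-1)^{i-1}\binom{l-1}{i-1}\frac{B_{l-1}}{(l-1)!}\,b_1\cdots\widehat{b_i}\cdots b_l\,\tilde\partial c_i\;+\;m_l(b_1,\dots,b_l).$$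 2. For every $i$ and every $x\in A^{0,0}$, $$m_l(a_1,\dots,a_{i-1},x,a_{i+1},\dots,a_l)=(-1)^{l-1}\binom{l-1}{i-1}\frac{B_{l-1}}{(l-1)!}\,b_1\cdots\widehat{b_i}\cdots b_l\,\tilde\partial x,$$ and if two or more of the arguments $a_i$ are replaced by elements of $A^{0,0}$, then the value of $m_l$ is $0$. -/

import Mathlib

open CategoryTheory TensorProduct Simplicial

universe v u

noncomputable section

/-! ### Commutative differential graded algebras -/

/-- A unital, non-negatively graded commutative differential graded algebra over `k`
(cohomological grading: the differential has degree `+1`). -/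
structure CDGA (k : Type u) [Field k] where
  carrier : Type v
  [ring : Ring carrier]
  [algebra : Algebra k carrier]
  gr : ℕ → Submodule k carrier
  [graded : GradedAlgebra gr]
  d : carrier →ₗ[k] carrier
  d_mem : ∀ {i : ℕ} {a : carrier}, a ∈ gr i → d a ∈ gr (i + 1)
  d_d : ∀ a : carrier, d (d a) = 0
  leibniz : ∀ {i : ℕ} {a : carrier}, a ∈ gr i → ∀ b : carrier,
    d (a * b) = d a * b + (-1 : k) ^ i • (a * d b)
  comm : ∀ {i j : ℕ} {a b : carrier}, a ∈ gr i → b ∈ gr j → a * b = (-1 : k) ^ (i * j) • (b * a)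

attribute [instance] CDGA.ring CDGA.algebra CDGA.graded

namespace CDGA

variable {k : Type u} [Field k]

/-- Morphisms: unital algebra maps of degree `0` commuting with the differentials. -/
@[ext]
structure Hom (A B : CDGA.{v} k) where
  toAlgHom : A.carrier →ₐ[k] B.carrier
  map_mem : ∀ {i : ℕ} {a : A.carrier}, a ∈ A.gr i → toAlgHom a ∈ B.gr i
  map_d : ∀ a : A.carrier, toAlgHom (A.d a) = B.d (toAlgHom a)

instance : Category.{v} (CDGA.{v} k) where
  Hom := Hom
  id A := { toAlgHom := AlgHom.id k A.carrier, map_mem := fun h => h, map_d := fun _ => rfl }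
  comp f g :=
    { toAlgHom := g.toAlgHom.comp f.toAlgHom
      map_mem := fun h => g.map_mem (f.map_mem h)
      map_d := fun a => by simp [f.map_d, g.map_d] }

/-- The underlying algebra map of a morphism. -/
def algHom {A B : CDGA.{v} k} (f : A ⟶ B) : A.carrier →ₐ[k] B.carrier := Hom.toAlgHom f

end CDGA

/-- The involution `a ↦ (-1)^{|a|} a` of a graded algebra. -/
def gradeSign {k : Type u} [Field k] {R : Type v} [Ring R] [Algebra k R]
    (𝒜 : ℕ → Submodule k R) [GradedAlgebra 𝒜] : R →ₗ[k] R :=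
  DirectSum.toModule k ℕ R (fun i => (-1 : k) ^ i • (𝒜 i).subtype) ∘ₗ
    (DirectSum.decomposeLinearEquiv 𝒜).toLinearMap

/-! ### Polynomial differential forms -/

section Forms

variable (k : Type u) [Field k]

/-- Polynomial differential forms on affine space with coordinates `x_j`, `j : σ`:
`k[x_j] ⊗ Λ(dx_j)`. -/
abbrev PolyForm (σ : Type) : Type u :=
  MvPolynomial σ k ⊗[k] ExteriorAlgebra k (σ → k)

/-- The forms of degree `p`. -/
def formGr (σ : Type) (p : ℕ) : Submodule k (PolyForm k σ) :=
  ((⋀[k]^p (σ → k)).baseChange (MvPolynomial σ k)).restrictScalars k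

instance formGraded (σ : Type) : GradedAlgebra (formGr k σ) :=
  let G : GradedAlgebra fun p : ℕ => (⋀[k]^p (σ → k)).baseChange (MvPolynomial σ k) :=
    inferInstance
  { one_mem := G.one_mem
    mul_mem := fun i j _ _ hi hj => G.mul_mem (i := i) (j := j) hi hj
    decompose' := fun x => (G.decompose' x)
    left_inv := G.left_inv
    right_inv := G.right_inv }

variable {k}

/-- A polynomial as a form of degree `0`. -/
def ofPoly {σ : Type} (f : MvPolynomial σ k) : PolyForm k σ := f ⊗ₜ 1

/-- The differential of a polynomial, `df = ∑ⱼ (∂f/∂xⱼ) dxⱼ`. -/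
def dPoly {σ : Type} [Fintype σ] [DecidableEq σ] (f : MvPolynomial σ k) : PolyForm k σ :=
  ∑ j : σ, MvPolynomial.pderiv j f ⊗ₜ ExteriorAlgebra.ι k (Pi.single j 1)

theorem dPoly_mul_self {σ : Type} [Fintype σ] [DecidableEq σ] (f : MvPolynomial σ k) :
    dPoly f * dPoly f = 0 := by
  simp only [dPoly, Finset.sum_mul_sum, Algebra.TensorProduct.tmul_mul_tmul]
  rw [← Finset.sum_product']
  refine Finset.sum_involution (fun p _ => (p.2, p.1)) ?_ ?_ ?_ ?_
  · rintro ⟨i, j⟩ _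
    rw [mul_comm (MvPolynomial.pderiv j f), ← TensorProduct.tmul_add,
      ExteriorAlgebra.ι_add_mul_swap, TensorProduct.tmul_zero]
  · rintro ⟨i, j⟩ _ hne h
    obtain rfl : j = i := by simpa using congrArg Prod.fst h
    exact hne (by rw [ExteriorAlgebra.ι_sq_zero, TensorProduct.tmul_zero])
  · simp
  · simp

/-- The pullback of constant-coefficient forms along a polynomial map `F`: `dxⱼ ↦ d(Fⱼ)`. -/
def pullbackExt {σ τ : Type} [Fintype σ] [Fintype τ] [DecidableEq τ] (F : σ → MvPolynomial τ k) :
    ExteriorAlgebra k (σ → k) →ₐ[k] PolyForm k τ :=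
  ExteriorAlgebra.lift k ⟨Fintype.linearCombination k fun j => dPoly (F j), fun c => by
    have h : Fintype.linearCombination k (fun j => dPoly (F j)) c =
        dPoly (∑ j, c j • F j) := by
      simp only [Fintype.linearCombination_apply, dPoly, Finset.smul_sum]
      rw [Finset.sum_comm]
      refine Finset.sum_congr rfl fun i _ => ?_
      rw [map_sum, TensorProduct.sum_tmul]
      refine Finset.sum_congr rfl fun j _ => ?_
      rw [Derivation.map_smul, TensorProduct.smul_tmul']
    rw [h]
    exact dPoly_mul_self _⟩

/-- The pullback of polynomial forms along the polynomial map with components `F`: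
`xⱼ ↦ Fⱼ`, `dxⱼ ↦ d(Fⱼ)`. -/
def pullback {σ τ : Type} [Fintype σ] [Fintype τ] [DecidableEq τ] (F : σ → MvPolynomial τ k) :
    PolyForm k σ →ₐ[k] PolyForm k τ :=
  Algebra.TensorProduct.lift
    (Algebra.TensorProduct.includeLeft.comp (MvPolynomial.aeval F)) (pullbackExt F)
    (fun f ω => Algebra.commutes (MvPolynomial.aeval F f) (pullbackExt F ω))

/-- Integration of polynomials in the variable `none` over `[0,1]`. -/
def intUnit {σ : Type} : MvPolynomial (Option σ) k →ₗ[k] MvPolynomial σ k :=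
  (MvPolynomial.basisMonomials (Option σ) k).constr k fun a =>
    MvPolynomial.monomial a.some (1 / ((a none : k) + 1))

/-- Integration of forms along the fibre of the projection `[0,1] × X → X`, where `none` is the
coordinate on `[0,1]`: forms without `du` are sent to `0` and
`f du ∧ ω` is sent to `(∫₀¹ f du) ω`. -/
def fibreInt {σ : Type} : PolyForm k (Option σ) →ₗ[k] PolyForm k σ :=
  TensorProduct.map intUnit
    ((ExteriorAlgebra.map (LinearMap.funLeft k k (some : σ → Option σ))).toLinearMap ∘ₗ
      CliffordAlgebra.contractLeft (Q := (0 : QuadraticForm k (Option σ → k)))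
        (LinearMap.proj none))

end Forms

/-! ### The simplicial algebra of polynomial forms on simplices and the Dupont contraction -/

section Dupont

variable (k : Type u) [Field k]

/-- Polynomial differential forms on the `n`-simplex. The algebra generated by `t₀, …, tₙ` and
`dt₀, …, dtₙ` subject to `∑ tᵢ = 1` and `∑ dtᵢ = 0` is the free one on `t₁, …, tₙ`; the coordinate
`j : Fin n` is `t_{j+1}`. -/
abbrev Om (n : ℕ) : Type u := PolyForm k (Fin n)

/-- The barycentric coordinates `t₀ = 1 - t₁ - ⋯ - tₙ, t₁, …, tₙ`. -/
def bary (n : ℕ) (i : Fin (n + 1)) : MvPolynomial (Fin n) k :=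
  Fin.cases (1 - ∑ j, MvPolynomial.X j) MvPolynomial.X i

/-- The pullback of forms along the affine map of simplices `Δ[p] → Δ[n]` given on vertices
by `θ`: `tᵢ ↦ ∑_{θ(j) = i} tⱼ`. -/
def simplexPullback {p n : ℕ} (θ : Fin (p + 1) → Fin (n + 1)) : Om k n →ₐ[k] Om k p :=
  pullback fun i => ∑ j with θ j = i.succ, bary k p j

/-- Integration over the standard `p`-simplex oriented by `dt₁ ⋯ dt_p`:
`∫ t₁^{a₁} ⋯ t_p^{a_p} dt₁ ⋯ dt_p = a₁! ⋯ a_p! / (a₁ + ⋯ + a_p + p)!`,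
and forms of degree `≠ p` have integral `0`. -/
def simplexInt (p : ℕ) : Om k p →ₗ[k] k :=
  (TensorProduct.lid k k).toLinearMap ∘ₗ
    TensorProduct.map
      ((MvPolynomial.basisMonomials (Fin p) k).constr k fun a =>
        ((∏ i, (a i).factorial : ℕ) : k) / (((∑ i, a i) + p).factorial : k))
      (ExteriorAlgebra.liftAlternating
        (Pi.single (M := fun i => (Fin p → k) [⋀^Fin i]→ₗ[k] k) p Matrix.detRowAlternating))

/-- The faces of the `n`-simplex: the inclusions `[p] ↪ [n]` for `p ≤ n`. -/
abbrev Face (n : ℕ) : Type := Σ p : Fin (n + 1), Fin (p.val + 1) ↪o Fin (n + 1)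

instance (n : ℕ) : DecidableEq (Face n) := Classical.decEq _

/-- The face `[n] ↪ [n]` of top dimension. -/
def topFace (n : ℕ) : Face n := ⟨Fin.last n, RelEmbedding.refl _⟩

/-- The normalized cochains `NC_n` of the `n`-simplex: functions on the set of faces. -/
abbrev NC (n : ℕ) : Type u := Face n → k

variable {k}

/-- The Whitney form
`ω_{i₀…i_p} = p! ∑ⱼ (-1)ʲ t_{iⱼ} dt_{i₀} ∧ ⋯ ∧ (omit dt_{iⱼ}) ∧ ⋯ ∧ dt_{i_p}`. -/
def whitney {p n : ℕ} (s : Fin (p + 1) → Fin (n + 1)) : Om k n :=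
  (p.factorial : k) • ∑ j : Fin (p + 1), (-1 : k) ^ j.val •
    (ofPoly (bary k n (s j)) *
      (List.ofFn fun r : Fin p => dPoly (bary k n (s (j.succAbove r)))).prod)

variable (k)

/-- The inclusion `E_n : NC_n → Ω(n)`. -/
def whitneyMap (n : ℕ) : NC k n →ₗ[k] Om k n :=
  Fintype.linearCombination k fun s : Face n => whitney s.2

/-- The integration map `∫_n : Ω(n) → NC_n`. -/
def integrationMap (n : ℕ) : Om k n →ₗ[k] NC k n :=
  LinearMap.pi fun s : Face n => simplexInt k s.1 ∘ₗ (simplexPullback k s.2).toLinearMap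

/-- The map `φᵢ(u, t) = u t + (1 - u) eᵢ` from `[0,1] × Δ[n]` to `Δ[n]`, in coordinates. -/
def cone (n : ℕ) (i : Fin (n + 1)) (j : Fin n) : MvPolynomial (Option (Fin n)) k :=
  MvPolynomial.X none * MvPolynomial.X (some j) +
    (1 - MvPolynomial.X none) * (if j.succ = i then 1 else 0)

/-- The operator `hⁱ = π_* φᵢ^*` of degree `-1`. The fibre `[0,1]` is oriented from the identity
(`u = 1`) to the vertex `eᵢ` (`u = 0`), so that `d hⁱ + hⁱ d` is the evaluation at `eᵢ` minus the
identity. -/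
def coneOp (n : ℕ) (i : Fin (n + 1)) : Module.End k (Om k n) :=
  -(fibreInt ∘ₗ (pullback (cone k n i)).toLinearMap)

/-- The Dupont homotopy `s_n ω = ∑_{i₀ < ⋯ < iⱼ} ω_{i₀…iⱼ} ∧ h^{iⱼ} ⋯ h^{i₀} ω`, which satisfies
`d s_n + s_n d = E_n ∫_n - Id`. -/
def dupont (n : ℕ) : Om k n →ₗ[k] Om k n :=
  ∑ s : Face n, LinearMap.mulLeft k (whitney s.2) ∘ₗ
    (List.ofFn fun j => coneOp k n (s.2 j)).reverse.prod

end Dupont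

/-! ### Homotopy transfer -/

section Transfer

variable {k : Type u} [Field k] {V W : Type*} [AddCommGroup V] [Module k V] [Ring W] [Algebra k W]

/-- The kernels of the homotopy transfer theorem for a dg algebra `W` with sign involution
`ε(w) = (-1)^{|w|} w` and homotopy `h`:
`P_n = ∑_{a+b=n} (-1)^{a(b+1)} μ ∘ (h P_a ⊗ h P_b)` with the convention `h P_1 = Id`.
By the Koszul rule the operator `h P_b`, of degree `1 - b`, contributes the sign
`(-1)^{(b+1)(|v₁| + ⋯ + |v_a|)}`, expressed through `ε`. -/
def transferKernel (ε h : W →ₗ[k] W) (n : ℕ) (v : Fin n → W) : W :=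
  ∑ a : Fin n, if ha : 0 < a.val then
      let x : Fin a.val → W := fun j => (ε ^ (n - a.val + 1)) (v ⟨j.val, by omega⟩)
      let y : Fin (n - a.val) → W := fun j => v ⟨a.val + j.val, by omega⟩
      (-1 : k) ^ (a.val * (n - a.val + 1)) •
        ((if h1 : a.val = 1 then x ⟨0, ha⟩ else h (transferKernel ε h a.val x)) *
          (if h1 : n - a.val = 1 then y ⟨0, by omega⟩ else h (transferKernel ε h (n - a.val) y)))
    else 0
termination_by n

/-- The operations `m_n = p ∘ P_n ∘ i^{⊗n}`, `n ≥ 2`, transferred from the dg algebra `W` to `V`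
along `i : V → W`, `p : W → V` and a homotopy `h` with `d h + h d = i p - Id`. -/
def transferred (ε h : W →ₗ[k] W) (i : V →ₗ[k] W) (p : W →ₗ[k] V) (n : ℕ) (v : Fin n → V) : V :=
  p (transferKernel ε h n fun j => i (v j))

end Transfer

/-! ### The total complex of a cosimplicial commutative dg algebra -/

namespace CosimplicialCDGA

variable {k : Type u} [Field k] (A : CosimplicialObject (CDGA.{v} k))

/-- `A^{n,•}`. -/
abbrev lvl (n : ℕ) : Type v := (A.obj ⦋n⦌).carrier

/-- `A^{n,q}`. -/
abbrev bideg (n q : ℕ) : Submodule k (lvl A n) := (A.obj ⦋n⦌).gr q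

/-- The conormalized module `N(A)^n`: the common kernel of the codegeneracies. -/
def normalized (n : ℕ) : Submodule k (lvl A n) :=
  match n with
  | 0 => ⊤
  | _ + 1 => ⨅ i, LinearMap.ker (CDGA.algHom (A.σ i)).toLinearMap

/-- Families `(a_p)` with `a_p ∈ A^{p,•}`. -/
abbrev Cochain : Type v := (n : ℕ) → lvl A n

/-- `Tot_N^m(A)`: the families `(a_p)` with `a_p ∈ N(A)^{p, m - p}` for `p ≤ m`, and
`a_p = 0` for `p > m`. -/
def totN (m : ℕ) : Submodule k (Cochain A) where
  carrier := {a | ∀ p, a p ∈ normalized A p ∧ (p ≤ m → a p ∈ bideg A p (m - p)) ∧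
    (m < p → a p = 0)}
  add_mem' ha hb p :=
    ⟨add_mem (ha p).1 (hb p).1, fun h => add_mem ((ha p).2.1 h) ((hb p).2.1 h),
      fun h => by simp [(ha p).2.2 h, (hb p).2.2 h]⟩
  zero_mem' p := ⟨zero_mem _, fun _ => zero_mem _, fun _ => rfl⟩
  smul_mem' c _ ha p :=
    ⟨Submodule.smul_mem _ c (ha p).1, fun h => Submodule.smul_mem _ c ((ha p).2.1 h),
      fun h => by simp [(ha p).2.2 h]⟩

/-- An element of `A^{p,•}` as a family concentrated in cosimplicial degree `p`. -/
def incl (p : ℕ) (x : lvl A p) : Cochain A := Pi.single p x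

/-- The differential `∂̃ = d⁰ - d¹ : A^{0,•} → A^{1,•}`. -/
def partialTilde (x : lvl A 0) : lvl A 1 :=
  CDGA.algHom (A.δ (0 : Fin 2)) x - CDGA.algHom (A.δ (1 : Fin 2)) x

/-- The graded algebra `Ω(n) ⊗ A^{n,•}`, with the Koszul sign in its product. -/
abbrev OmA (n : ℕ) : Type (max u v) := (formGr k (Fin n)) ᵍ⊗[k] (A.obj ⦋n⦌).gr

/-- A linear operator on `Ω(n) ⊗ A^{n,•}` from one on the underlying tensor product. -/
def liftOp {n : ℕ} (f : Om k n ⊗[k] lvl A n →ₗ[k] Om k n ⊗[k] lvl A n) :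
    OmA A n →ₗ[k] OmA A n :=
  (GradedTensorProduct.of k (formGr k (Fin n)) (A.obj ⦋n⦌).gr).conj f

/-- The sign `(-1)^{|ω| + |a|}` on `Ω(n) ⊗ A^{n,•}`. -/
def signOp (n : ℕ) : OmA A n →ₗ[k] OmA A n :=
  liftOp A (TensorProduct.map (gradeSign (formGr k (Fin n))) (gradeSign (A.obj ⦋n⦌).gr))

/-- The homotopy `s_n ⊗ Id`. -/
def homotopyOp (n : ℕ) : OmA A n →ₗ[k] OmA A n :=
  liftOp A ((dupont k n).rTensor (lvl A n))

/-- The inclusion `E_n ⊗ Id : NC_n ⊗ A^{n,•} → Ω(n) ⊗ A^{n,•}`. -/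
def inclOp (n : ℕ) : NC k n ⊗[k] lvl A n →ₗ[k] OmA A n :=
  (GradedTensorProduct.of k (formGr k (Fin n)) (A.obj ⦋n⦌).gr).toLinearMap ∘ₗ
    (whitneyMap k n).rTensor (lvl A n)

/-- The integration `∫_n ⊗ Id : Ω(n) ⊗ A^{n,•} → NC_n ⊗ A^{n,•}`. -/
def intOp (n : ℕ) : OmA A n →ₗ[k] NC k n ⊗[k] lvl A n :=
  (integrationMap k n).rTensor (lvl A n) ∘ₗ
    (GradedTensorProduct.of k (formGr k (Fin n)) (A.obj ⦋n⦌).gr).symm.toLinearMap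

/-- The operations on `NC_n ⊗ A^{n,•}` transferred from the dg algebra `Ω(n) ⊗ A^{n,•}`. -/
def levelMul (n l : ℕ) (v : Fin l → NC k n ⊗[k] lvl A n) : NC k n ⊗[k] lvl A n :=
  transferred (signOp A n) (homotopyOp A n) (inclOp A n) (intOp A n) l v

/-- The isomorphism `ψ` from `Tot_N(A)` to the (co)end of `NC_n ⊗ A^{n,•}`, whose elements are
compatible families `(v_n)`: it sends `a` to `v_n = ∑_σ λ_σ ⊗ σ_*(a_p)`, the sum being over the
inclusions `σ : [p] ↪ [n]`. -/
def psi (a : Cochain A) (n : ℕ) : NC k n ⊗[k] lvl A n :=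
  ∑ s : Face n, (Pi.single s 1 : NC k n) ⊗ₜ[k]
    CDGA.algHom (A.map (SimplexCategory.Hom.mk (a := ⦋s.1.val⦌) (b := ⦋n⦌) s.2.toOrderHom))
      (a s.1.val)

/-- The inverse of `ψ`: the component in cosimplicial degree `p` is the coefficient of
`λ_{0…p}` in `v_p`. -/
def psiInv (v : (n : ℕ) → NC k n ⊗[k] lvl A n) : Cochain A := fun p =>
  TensorProduct.lid k (lvl A p) ((LinearMap.proj (topFace p)).rTensor (lvl A p) (v p))

/-- The operation `m_l`, `l ≥ 2`, of the `C_∞`-structure on `Tot_N(A)`: transport along `ψ` of the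
operation acting on families `(v_n)` componentwise by the transferred operations. -/
def totMul (l : ℕ) (a : Fin l → Cochain A) : Cochain A :=
  psiInv A fun n => levelMul A n l fun r => psi A (a r) n

end CosimplicialCDGA

end

/-!
The transferred operation `m_l` is computed separately in each cosimplicial degree `p`, where it is
the integral over the `p`-simplex of the transfer kernel `P_l` evaluated at the Whitney forms of
the arguments.

* For `p = 0` the Dupont homotopy vanishes (`dupont_zero`), and so does `P_l` for `l > 2`.

* For `p ≥ 2` a degree count suffices. The homotopy lowers the degree of forms by one, so that
  the filtration of `Ω(p) ⊗ A^{p,•}` by form degree is respected by the kernels: arguments of form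
  degree at most one have kernels of form degree at most two, and changing the arguments by
  functions changes the kernels by forms of degree at most one (`transferSeq_mem_and_sub_mem`),
  whose integrals over the `p`-simplex vanish. Thus the elements of `A^{0,•}` do not contribute.

* For `p = 1` the arguments are `dt ⊗ bⱼ + 1 ⊗ eⱼ + t ⊗ gⱼ` with `gⱼ = ∂̃cⱼ`. The homotopy kills
  functions and its values are functions, so that in the kernel only the two outermost terms
  `dt b₀ · h P_{l-1}` and `h P_{l-1} · dt b_{l-1}` matter
  (`transferFactor_mem_and_transferSeq_sub_mem`).
  With `βₙ = (Bₙ(t) - Bₙ) / n!` one has `h(βₙ dt) = -βₙ₊₁` (`dupont_bernoulliForm`), while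
  `h(dt) = 0`. Hence `h P_l` is a combination of the `β_l ⊗ b₀ ⋯ (omit bⱼ) ⋯ gⱼ`, whose
  coefficients are determined by Pascal's rule (`binomialSum_pascal`,
  `transferFactor_eq_binomialSum`). The integral of `β_{l-1} dt` is `-B_{l-1} / (l-1)!`.

The sign obtained for arguments `gⱼ` of degree one is `(-1)^{(l-1)+(l-1-j)}`. It agrees with
`(-1)^{(l-1)+j}` when `l - 1` is even; when `l - 1 ≥ 3` is odd, the Bernoulli number is zero.
-/

noncomputable section

/-! ### The degree of polynomial forms -/

section FormDegree

variable {k : Type u} [Field k]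

theorem tmul_mem_formGr {σ : Type} {p : ℕ} (f : MvPolynomial σ k) {ω : ExteriorAlgebra k (σ → k)}
    (hω : ω ∈ ⋀[k]^p (σ → k)) : f ⊗ₜ[k] ω ∈ formGr k σ p :=
  Submodule.tmul_mem_baseChange_of_mem f hω

theorem formGr_le {σ : Type} {p : ℕ} {S : Submodule k (PolyForm k σ)}
    (h : ∀ (f : MvPolynomial σ k) (ω : ExteriorAlgebra k (σ → k)), ω ∈ ⋀[k]^p (σ → k) →
      f ⊗ₜ ω ∈ S) : formGr k σ p ≤ S := by
  rintro x ⟨y, rfl⟩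
  induction y using TensorProduct.induction_on with
  | zero => rw [map_zero]; exact zero_mem _
  | tmul f ω => exact h f ω ω.2
  | add x y hx hy => rw [map_add]; exact add_mem hx hy

theorem mem_formGr_zero_ofPoly {σ : Type} (f : MvPolynomial σ k) : ofPoly f ∈ formGr k σ 0 :=
  tmul_mem_formGr f (by
    rw [ExteriorAlgebra.exteriorPower, pow_zero]; exact Submodule.one_le.mp le_rfl)

theorem mul_mem_formGr {σ : Type} {p q : ℕ} {x y : PolyForm k σ} (hx : x ∈ formGr k σ p)
    (hy : y ∈ formGr k σ q) : x * y ∈ formGr k σ (p + q) :=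
  SetLike.GradedMul.mul_mem hx hy

theorem dPoly_mem_formGr {σ : Type} [Fintype σ] [DecidableEq σ] (f : MvPolynomial σ k) :
    dPoly f ∈ formGr k σ 1 :=
  Submodule.sum_mem _ fun j _ => tmul_mem_formGr _ (by
    rw [ExteriorAlgebra.exteriorPower, pow_one]; exact LinearMap.mem_range_self _ _)

/-- An algebra map from the exterior algebra to a graded algebra has degree `0` if it does so on
generators. -/
theorem AlgHom.map_mem_of_mem_exteriorPower {M R : Type*} [AddCommGroup M] [Module k M]
    [Ring R] [Algebra k R] (𝒜 : ℕ → Submodule k R) [SetLike.GradedMonoid 𝒜]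
    (f : ExteriorAlgebra k M →ₐ[k] R) (hf : ∀ m, f (ExteriorAlgebra.ι k m) ∈ 𝒜 1) {p : ℕ}
    {ω : ExteriorAlgebra k M} (hω : ω ∈ ⋀[k]^p M) : f ω ∈ 𝒜 p := by
  induction hω using Submodule.pow_induction_on_left' with
  | algebraMap r => simpa using SetLike.algebraMap_mem_graded 𝒜 r
  | add x y i hx hy ihx ihy => rw [map_add]; exact add_mem ihx ihy
  | mem_mul m hm i x hx ih =>
    obtain ⟨m, rfl⟩ := hm
    rw [map_mul, Nat.succ_eq_add_one, add_comm]
    exact SetLike.GradedMul.mul_mem (hf m) ih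

section Pullback

variable {σ τ : Type} [Fintype σ] [Fintype τ] [DecidableEq τ] (F : σ → MvPolynomial τ k)

theorem pullbackExt_ι (c : σ → k) :
    pullbackExt F (ExteriorAlgebra.ι k c) = ∑ j, c j • dPoly (F j) := by
  simp [pullbackExt, Fintype.linearCombination_apply]

theorem pullback_tmul (f : MvPolynomial σ k) (ω : ExteriorAlgebra k (σ → k)) :
    pullback F (f ⊗ₜ ω) = ofPoly (MvPolynomial.aeval F f) * pullbackExt F ω := rfl

theorem pullback_mem_formGr {p : ℕ} {x : PolyForm k σ} (hx : x ∈ formGr k σ p) :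
    pullback F x ∈ formGr k τ p := by
  refine formGr_le (S := (formGr k τ p).comap (pullback F).toLinearMap) (fun f ω hω => ?_) hx
  change pullback F (f ⊗ₜ ω) ∈ formGr k τ p
  rw [pullback_tmul, ← zero_add p]
  refine mul_mem_formGr (mem_formGr_zero_ofPoly _)
    (AlgHom.map_mem_of_mem_exteriorPower (formGr k τ) _ (fun c => ?_) hω)
  rw [pullbackExt_ι]
  exact Submodule.sum_mem _ fun j _ => Submodule.smul_mem _ _ (dPoly_mem_formGr _)

end Pullback

theorem contractLeft_eq_zero_of_mem_exteriorPower_zero {M : Type*} [AddCommGroup M] [Module k M]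
    (d : Module.Dual k M) {ω : ExteriorAlgebra k M} (hω : ω ∈ ⋀[k]^0 M) :
    CliffordAlgebra.contractLeft (Q := (0 : QuadraticForm k M)) d ω = 0 := by
  rw [ExteriorAlgebra.exteriorPower, pow_zero] at hω
  obtain ⟨r, rfl⟩ := Submodule.mem_one.mp hω
  exact CliffordAlgebra.contractLeft_algebraMap _ _ r

theorem contractLeft_mem_exteriorPower {M : Type*} [AddCommGroup M] [Module k M]
    (d : Module.Dual k M) {p : ℕ} {ω : ExteriorAlgebra k M} (hω : ω ∈ ⋀[k]^(p + 1) M) :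
    CliffordAlgebra.contractLeft (Q := (0 : QuadraticForm k M)) d ω ∈ ⋀[k]^p M := by
  induction p generalizing ω with
  | zero =>
    rw [ExteriorAlgebra.exteriorPower, zero_add, pow_one] at hω
    obtain ⟨m, rfl⟩ := hω
    rw [ExteriorAlgebra.exteriorPower, pow_zero]
    exact Submodule.mem_one.mpr ⟨d m, (CliffordAlgebra.contractLeft_ι _ _ m).symm⟩
  | succ p ih =>
    rw [ExteriorAlgebra.exteriorPower, pow_succ'] at hω
    induction hω using Submodule.mul_induction_on' with
    | mem_mul_mem m hm x hx =>
      obtain ⟨m, rfl⟩ := hm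
      have := CliffordAlgebra.contractLeft_ι_mul (Q := (0 : QuadraticForm k M)) d m x
      refine this ▸ sub_mem (Submodule.smul_mem _ _ hx) ?_
      rw [ExteriorAlgebra.exteriorPower, pow_succ']
      exact Submodule.mul_mem_mul (LinearMap.mem_range_self _ m) (ih hx)
    | add x _ y _ hx hy => rw [map_add]; exact add_mem hx hy

theorem fibreInt_tmul {σ : Type} (f : MvPolynomial (Option σ) k)
    (ω : ExteriorAlgebra k (Option σ → k)) :
    fibreInt (f ⊗ₜ ω) = intUnit f ⊗ₜ
      ExteriorAlgebra.map (LinearMap.funLeft k k (some : σ → Option σ))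
        (CliffordAlgebra.contractLeft (Q := (0 : QuadraticForm k (Option σ → k)))
          (LinearMap.proj none) ω) := rfl

theorem fibreInt_mem_formGr {σ : Type} {p : ℕ} {x : PolyForm k (Option σ)}
    (hx : x ∈ formGr k (Option σ) (p + 1)) : fibreInt x ∈ formGr k σ p := by
  refine formGr_le (S := (formGr k σ p).comap fibreInt) (fun f ω hω => ?_) hx
  change fibreInt (f ⊗ₜ ω) ∈ formGr k σ p
  rw [fibreInt_tmul]
  refine tmul_mem_formGr _ (AlgHom.map_mem_of_mem_exteriorPower (fun i => ⋀[k]^i (σ → k)) _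
    (fun c => ?_) (contractLeft_mem_exteriorPower _ hω))
  rw [ExteriorAlgebra.map_apply_ι, ExteriorAlgebra.exteriorPower, pow_one]
  exact LinearMap.mem_range_self _ _

theorem fibreInt_eq_zero {σ : Type} {x : PolyForm k (Option σ)}
    (hx : x ∈ formGr k (Option σ) 0) : fibreInt x = 0 := by
  refine formGr_le (S := LinearMap.ker (fibreInt (k := k) (σ := σ))) (fun f ω hω => ?_) hx
  rw [LinearMap.mem_ker]
  rw [fibreInt_tmul, contractLeft_eq_zero_of_mem_exteriorPower_zero _ hω, map_zero, tmul_zero]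

/-- The operators `hⁱ` have degree `-1`. -/
theorem coneOp_mem_formGr {n : ℕ} (i : Fin (n + 1)) {p : ℕ} {x : Om k n}
    (hx : x ∈ formGr k (Fin n) (p + 1)) : coneOp k n i x ∈ formGr k (Fin n) p :=
  neg_mem (fibreInt_mem_formGr (pullback_mem_formGr _ hx))

theorem coneOp_eq_zero {n : ℕ} (i : Fin (n + 1)) {x : Om k n}
    (hx : x ∈ formGr k (Fin n) 0) : coneOp k n i x = 0 := by
  have := fibreInt_eq_zero (pullback_mem_formGr (cone k n i) hx)
  simp [coneOp, this]

theorem coneOp_prod_mem_formGr {n : ℕ} (L : List (Fin (n + 1))) {p : ℕ} {x : Om k n}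
    (hx : x ∈ formGr k (Fin n) (p + L.length)) :
    (L.map (coneOp k n)).prod x ∈ formGr k (Fin n) p := by
  induction L generalizing p with
  | nil => simpa using hx
  | cons i L ih =>
    rw [List.map_cons, List.prod_cons, Module.End.mul_apply]
    refine coneOp_mem_formGr i (ih ?_)
    rwa [List.length_cons, add_comm L.length, ← add_assoc] at hx

theorem coneOp_prod_eq_zero {n : ℕ} (L : List (Fin (n + 1))) {p : ℕ} {x : Om k n}
    (hx : x ∈ formGr k (Fin n) p) (hp : p < L.length) :
    (L.map (coneOp k n)).prod x = 0 := by
  induction L with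
  | nil => simp at hp
  | cons i L ih =>
    rw [List.map_cons, List.prod_cons, Module.End.mul_apply]
    rcases Nat.lt_succ_iff_lt_or_eq.mp hp with h | h
    · rw [ih h, map_zero]
    · exact coneOp_eq_zero i (coneOp_prod_mem_formGr L (by simpa [← h] using hx))

theorem ofFn_coneOp_reverse {p n : ℕ} (s : Fin (p + 1) → Fin (n + 1)) :
    (List.ofFn fun j => coneOp k n (s j)).reverse =
      (List.ofFn s).reverse.map (coneOp k n) := by
  rw [List.map_reverse, List.map_ofFn]; rfl

theorem whitney_mem_formGr {p n : ℕ} (s : Fin (p + 1) → Fin (n + 1)) :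
    whitney s ∈ formGr k (Fin n) p := by
  refine Submodule.smul_mem _ _ (Submodule.sum_mem _ fun j _ => Submodule.smul_mem _ _ ?_)
  have := SetLike.list_prod_ofFn_mem_graded (A := formGr k (Fin n)) (fun _ : Fin p => 1)
    (fun r => dPoly (bary k n (s (j.succAbove r)))) (fun r => dPoly_mem_formGr _)
  simpa using mul_mem_formGr (mem_formGr_zero_ofPoly (bary k n (s j))) this

theorem dupont_apply (n : ℕ) (x : Om k n) : dupont k n x = ∑ s : Face n,
    whitney s.2 * (List.ofFn fun j => coneOp k n (s.2 j)).reverse.prod x := by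
  simp [dupont]

/-- The Dupont homotopy has degree `-1`. -/
theorem dupont_mem_formGr {n p : ℕ} {x : Om k n} (hx : x ∈ formGr k (Fin n) (p + 1)) :
    dupont k n x ∈ formGr k (Fin n) p := by
  rw [dupont_apply]
  refine Submodule.sum_mem _ fun s _ => ?_
  rw [ofFn_coneOp_reverse]
  rcases lt_or_ge p s.1.val with h | h
  · rw [coneOp_prod_eq_zero _ hx (by simpa using h), mul_zero]
    exact zero_mem _
  · have := mul_mem_formGr (whitney_mem_formGr (k := k) s.2)
      (coneOp_prod_mem_formGr (List.ofFn s.2).reverse (p := p - s.1.val) (x := x) (by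
        rwa [List.length_reverse, List.length_ofFn, ← add_assoc, Nat.sub_add_cancel h]))
    rwa [Nat.add_sub_cancel' h] at this

theorem dupont_eq_zero {n : ℕ} {x : Om k n} (hx : x ∈ formGr k (Fin n) 0) :
    dupont k n x = 0 := by
  rw [dupont_apply]
  refine Finset.sum_eq_zero fun s _ => ?_
  rw [ofFn_coneOp_reverse, coneOp_prod_eq_zero _ hx (by simp), mul_zero]

theorem simplexInt_eq_zero {p q : ℕ} (hpq : q ≠ p) {x : Om k p} (hx : x ∈ formGr k (Fin p) q) :
    simplexInt k p x = 0 := by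
  refine formGr_le (S := LinearMap.ker (simplexInt k p)) (fun f ω hω => ?_) hx
  rw [LinearMap.mem_ker]
  suffices h : ExteriorAlgebra.liftAlternating
      (Pi.single (M := fun i => (Fin p → k) [⋀^Fin i]→ₗ[k] k) p Matrix.detRowAlternating) ω = 0 by
    simp [simplexInt, h]
  rw [← ExteriorAlgebra.ιMulti_span_fixedDegree] at hω
  induction hω using Submodule.span_induction with
  | mem x hx =>
    obtain ⟨v, rfl⟩ := hx
    rw [ExteriorAlgebra.liftAlternating_apply_ιMulti, Pi.single_eq_of_ne hpq,
      AlternatingMap.zero_apply]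
  | zero => rw [map_zero]
  | add x y _ _ hx hy => rw [map_add, hx, hy, add_zero]
  | smul a x _ hx => rw [map_smul, hx, smul_zero]

/-- On a point there are no forms of positive degree, so that the Dupont homotopy vanishes. -/
theorem dupont_zero : dupont k 0 = 0 := by
  refine TensorProduct.ext' fun f ω => ?_
  refine dupont_eq_zero (tmul_mem_formGr f ?_)
  rw [ExteriorAlgebra.exteriorPower, pow_zero]
  induction ω using ExteriorAlgebra.induction with
  | algebraMap r => exact Submodule.algebraMap_mem r
  | ι m => rw [Subsingleton.elim m 0, map_zero]; exact zero_mem _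
  | mul a b ha hb => simpa using Submodule.mul_mem_mul ha hb
  | add a b ha hb => exact add_mem ha hb

theorem gradeSign_apply {R : Type v} [Ring R] [Algebra k R] (𝒜 : ℕ → Submodule k R)
    [GradedAlgebra 𝒜] {i : ℕ} {a : R} (ha : a ∈ 𝒜 i) : gradeSign 𝒜 a = (-1 : k) ^ i • a := by
  simp only [gradeSign, LinearMap.comp_apply, LinearEquiv.coe_coe,
    DirectSum.decomposeLinearEquiv_apply]
  rw [DirectSum.decompose_of_mem 𝒜 ha, ← DirectSum.lof_eq_of k, DirectSum.toModule_lof]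
  rfl

end FormDegree

/-! ### Exact one-forms and the cone operators -/

section ExactForms

variable {k : Type u} [Field k]

theorem ofPoly_mul {σ : Type} (f g : MvPolynomial σ k) : ofPoly (f * g) = ofPoly f * ofPoly g := by
  simp [ofPoly]

theorem ofPoly_add {σ : Type} (f g : MvPolynomial σ k) : ofPoly (f + g) = ofPoly f + ofPoly g :=
  TensorProduct.add_tmul _ _ _

theorem ofPoly_sum {σ : Type} {ι : Type*} (s : Finset ι) (f : ι → MvPolynomial σ k) :
    ofPoly (∑ i ∈ s, f i) = ∑ i ∈ s, ofPoly (f i) :=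
  TensorProduct.sum_tmul _ _ _

theorem sum_bary (n : ℕ) : ∑ i, bary k n i = 1 := by
  simp [Fin.sum_univ_succ, bary]

theorem dPoly_add {σ : Type} [Fintype σ] [DecidableEq σ] (f g : MvPolynomial σ k) :
    dPoly (f + g) = dPoly f + dPoly g := by
  simp [dPoly, add_tmul, Finset.sum_add_distrib]

theorem dPoly_smul {σ : Type} [Fintype σ] [DecidableEq σ] (c : k) (f : MvPolynomial σ k) :
    dPoly (c • f) = c • dPoly f := by
  simp [dPoly, smul_tmul', Finset.smul_sum]

theorem dPoly_C {σ : Type} [Fintype σ] [DecidableEq σ] (c : k) :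
    dPoly (MvPolynomial.C c : MvPolynomial σ k) = 0 := by
  simp [dPoly]

theorem dPoly_mul {σ : Type} [Fintype σ] [DecidableEq σ] (f g : MvPolynomial σ k) :
    dPoly (f * g) = ofPoly f * dPoly g + ofPoly g * dPoly f := by
  simp only [dPoly, ofPoly, Finset.mul_sum, Algebra.TensorProduct.tmul_mul_tmul, one_mul,
    ← Finset.sum_add_distrib]
  refine Finset.sum_congr rfl fun j _ => ?_
  rw [← add_tmul, MvPolynomial.pderiv_mul, add_comm, mul_comm _ g]

theorem dPoly_X {σ : Type} [Fintype σ] [DecidableEq σ] (i : σ) :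
    dPoly (MvPolynomial.X i : MvPolynomial σ k) = 1 ⊗ₜ ExteriorAlgebra.ι k (Pi.single i 1) := by
  rw [dPoly, Finset.sum_eq_single i]
  · rw [MvPolynomial.pderiv_X_self]
  · intro j _ hj
    rw [MvPolynomial.pderiv_X_of_ne (Ne.symm hj), zero_tmul]
  · simp

section Pullback

variable {σ τ : Type} [Fintype σ] [Fintype τ] [DecidableEq τ] (F : σ → MvPolynomial τ k)

theorem pullback_ofPoly (f : MvPolynomial σ k) :
    pullback F (ofPoly f) = ofPoly (MvPolynomial.aeval F f) := by
  rw [ofPoly, pullback_tmul, map_one, mul_one]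

theorem pullback_one_tmul_ι (c : σ → k) :
    pullback F (1 ⊗ₜ ExteriorAlgebra.ι k c) = ∑ j, c j • dPoly (F j) := by
  rw [pullback_tmul, map_one, pullbackExt_ι]
  exact one_mul _

/-- The chain rule: pullbacks commute with the differential of polynomials. -/
theorem pullback_dPoly [DecidableEq σ] (f : MvPolynomial σ k) :
    pullback F (dPoly f) = dPoly (MvPolynomial.aeval F f) := by
  induction f using MvPolynomial.induction_on with
  | C c => rw [dPoly_C, map_zero, MvPolynomial.aeval_C]; exact (dPoly_C c).symm
  | add f g hf hg => rw [dPoly_add, map_add, map_add, dPoly_add, hf, hg]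
  | mul_X f i hf =>
    rw [dPoly_mul, map_add, map_mul, map_mul, map_mul, dPoly_mul, hf, pullback_ofPoly,
      pullback_ofPoly, MvPolynomial.aeval_X, dPoly_X, pullback_one_tmul_ι,
      Finset.sum_eq_single i]
    · rw [Pi.single_eq_same, one_smul]
    · intro j _ hj
      rw [Pi.single_eq_of_ne hj, zero_smul]
    · simp

theorem pullback_X [DecidableEq σ] (x : PolyForm k σ) :
    pullback (MvPolynomial.X : σ → MvPolynomial σ k) x = x := by
  have h : pullback (MvPolynomial.X : σ → MvPolynomial σ k) = AlgHom.id k _ := by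
    refine Algebra.TensorProduct.ext (AlgHom.ext fun f => ?_) (ExteriorAlgebra.hom_ext
      (LinearMap.pi_ext' fun i => LinearMap.ext_ring ?_))
    · change pullback (MvPolynomial.X : σ → MvPolynomial σ k) (ofPoly f) = ofPoly f
      rw [pullback_ofPoly, MvPolynomial.aeval_X_left_apply]
    · change pullback (MvPolynomial.X : σ → MvPolynomial σ k)
        (1 ⊗ₜ ExteriorAlgebra.ι k (Pi.single i 1)) = 1 ⊗ₜ ExteriorAlgebra.ι k (Pi.single i 1)
      rw [← dPoly_X, pullback_dPoly, MvPolynomial.aeval_X]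
  rw [h, AlgHom.id_apply]

end Pullback

theorem simplexPullback_id {p : ℕ} (x : Om k p) :
    simplexPullback k (id : Fin (p + 1) → _) x = x := by
  have h : (fun i : Fin p => ∑ j with id j = i.succ, bary k p j) = MvPolynomial.X := by
    funext i
    simp [Finset.filter_eq', bary]
  rw [simplexPullback, h, pullback_X]

theorem intUnit_monomial {σ : Type} (a : Option σ →₀ ℕ) (r : k) :
    intUnit (MvPolynomial.monomial a r) =
      MvPolynomial.monomial a.some (r / ((a none : k) + 1)) := by
  have h : (MvPolynomial.monomial a r : MvPolynomial (Option σ) k) =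
      r • MvPolynomial.basisMonomials (Option σ) k a := by
    simp [MvPolynomial.smul_monomial]
  rw [h, map_smul, intUnit, Module.Basis.constr_basis, MvPolynomial.smul_monomial, smul_eq_mul,
    mul_one_div]

/-- The fundamental theorem of calculus in the variable `none`. -/
theorem intUnit_pderiv_none [CharZero k] {σ : Type} (f : MvPolynomial (Option σ) k) :
    intUnit (MvPolynomial.pderiv none f) =
      MvPolynomial.aeval (fun o : Option σ => o.elim 1 MvPolynomial.X) f -
      MvPolynomial.aeval (fun o : Option σ => o.elim 0 MvPolynomial.X) f := by
  have h : intUnit ∘ₗ (MvPolynomial.pderiv (R := k) (none : Option σ)).toLinearMap =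
      (MvPolynomial.aeval fun o : Option σ =>
        (o.elim 1 MvPolynomial.X : MvPolynomial σ k)).toLinearMap -
      (MvPolynomial.aeval fun o : Option σ =>
        (o.elim 0 MvPolynomial.X : MvPolynomial σ k)).toLinearMap := by
    refine (MvPolynomial.basisMonomials (Option σ) k).ext fun a => ?_
    have ha : (a - Finsupp.single none 1).some = a.some := by
      ext i; simp
    have hX : (a.some.prod fun i e => (MvPolynomial.X i : MvPolynomial σ k) ^ e) =
        MvPolynomial.monomial a.some 1 := by
      simp [MvPolynomial.monomial_eq]
    have hp : ∀ f : Option σ → MvPolynomial σ k,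
        a.prod (fun i e => f i ^ e) = f none ^ a none * a.some.prod fun i e => f (some i) ^ e :=
      fun f => Finsupp.prod_option_index _ _ (fun _ => pow_zero _) (fun _ _ _ => pow_add _ _ _)
    simp only [MvPolynomial.coe_basisMonomials, LinearMap.comp_apply, LinearMap.sub_apply,
      AlgHom.toLinearMap_apply, Derivation.coeFn_coe]
    rw [MvPolynomial.pderiv_monomial, intUnit_monomial, ha, MvPolynomial.aeval_monomial,
      MvPolynomial.aeval_monomial, hp, hp]
    simp only [Option.elim, hX, map_one, one_mul, one_pow]
    rcases h : a none with _ | m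
    · simp
    · have h0 : ((m : k) + 1) ≠ 0 := by exact_mod_cast m.succ_ne_zero
      simp [h, h0]
  exact LinearMap.congr_fun h f

theorem fibreInt_dPoly {σ : Type} [Fintype σ] [DecidableEq σ] (f : MvPolynomial (Option σ) k) :
    fibreInt (dPoly f) = ofPoly (intUnit (MvPolynomial.pderiv none f)) := by
  rw [dPoly, map_sum, Finset.sum_eq_single none]
  · rw [fibreInt_tmul, CliffordAlgebra.contractLeft_ι]
    simp [ofPoly]
  · intro j _ hj
    rw [fibreInt_tmul, CliffordAlgebra.contractLeft_ι]
    simp [Pi.single_eq_of_ne hj.symm]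
  · simp

/-- The value of a polynomial at the vertex `eᵢ` of the simplex. -/
def evalVertex {n : ℕ} (i : Fin (n + 1)) : MvPolynomial (Fin n) k →ₐ[k] k :=
  MvPolynomial.aeval fun j => if j.succ = i then 1 else 0

/-- The homotopy identity for `hⁱ` on exact one-forms: `hⁱ(df) = f(eᵢ) - f`. -/
theorem coneOp_dPoly [CharZero k] {n : ℕ} (i : Fin (n + 1)) (f : MvPolynomial (Fin n) k) :
    coneOp k n i (dPoly f) = ofPoly (MvPolynomial.C (evalVertex i f) - f) := by
  have h : coneOp k n i (dPoly f) = - fibreInt (pullback (cone k n i) (dPoly f)) := rfl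
  rw [h, pullback_dPoly, fibreInt_dPoly, intUnit_pderiv_none]
  have h1 : MvPolynomial.aeval (fun o : Option (Fin n) => o.elim 1 MvPolynomial.X)
      (MvPolynomial.aeval (cone k n i) f) = f := by
    rw [← AlgHom.comp_apply, MvPolynomial.comp_aeval]
    conv_rhs => rw [← MvPolynomial.aeval_X_left_apply f]
    congr 2
    funext j
    simp only [cone]
    split_ifs <;> simp
  have h0 : MvPolynomial.aeval (fun o : Option (Fin n) => o.elim 0 MvPolynomial.X)
      (MvPolynomial.aeval (cone k n i) f) = MvPolynomial.C (evalVertex i f) := by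
    rw [← AlgHom.comp_apply, MvPolynomial.comp_aeval, evalVertex, ← MvPolynomial.algebraMap_eq,
      ← Algebra.ofId_apply, ← AlgHom.comp_apply, MvPolynomial.comp_aeval]
    congr 2
    funext j
    simp [cone, apply_ite]
  rw [h1, h0]
  simp [ofPoly, ← neg_tmul]

/-! ### Sums over faces and the Dupont homotopy on exact forms -/

/-- The vertex `i` of the `n`-simplex as a face. -/
def vertexFace {n : ℕ} (i : Fin (n + 1)) : Face n :=
  ⟨0, OrderEmbedding.ofStrictMono (fun _ : Fin (0 + 1) => i)
    (Subsingleton.strictMono (α := Fin 1) _)⟩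

theorem eq_vertexFace {n : ℕ} (s : Face n) (hs : s.1 = 0) : s = vertexFace (s.2 0) := by
  obtain ⟨p, s⟩ := s
  obtain rfl : p = 0 := hs
  refine Sigma.ext rfl (heq_of_eq (RelEmbedding.ext fun x => ?_))
  obtain rfl : x = 0 := by have := x.2; ext; change x.1 = 0; simp at this; omega
  rfl

theorem vertexFace_injective {n : ℕ} : Function.Injective (vertexFace (n := n)) := fun i j h => by
  simp only [vertexFace, Sigma.mk.injEq, heq_eq_eq, true_and] at h
  exact congrFun (congrArg DFunLike.coe h) 0

theorem sum_face_eq_sum_vertexFace {M : Type*} [AddCommMonoid M] {n : ℕ} (F : Face n → M)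
    (hF : ∀ s : Face n, s.1 ≠ 0 → F s = 0) : ∑ s, F s = ∑ i, F (vertexFace i) := by
  refine (Fintype.sum_of_injective vertexFace vertexFace_injective _ _ (fun s hs => ?_)
    fun _ => rfl).symm
  exact hF s fun h => hs ⟨_, (eq_vertexFace s h).symm⟩

theorem sum_face_one {M : Type*} [AddCommMonoid M] (F : Face 1 → M) :
    ∑ s, F s = F (vertexFace 0) + F (vertexFace 1) + F (topFace 1) := by
  have h : Function.Bijective (fun o : Option (Fin 2) => o.elim (topFace 1) vertexFace) := by
    refine ⟨?_, fun s => ?_⟩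
    · rintro (_ | i) (_ | j) h
      · rfl
      · exact absurd (congrArg Sigma.fst h) (by simp [topFace, vertexFace])
      · exact absurd (congrArg Sigma.fst h) (by simp [topFace, vertexFace])
      · exact congrArg some (vertexFace_injective h)
    · by_cases hs : s.1 = 0
      · exact ⟨some (s.2 0), (eq_vertexFace s hs).symm⟩
      · obtain ⟨p, s⟩ := s
        obtain rfl : p = Fin.last 1 := by fin_cases p <;> simp at hs ⊢
        refine ⟨none, Sigma.ext rfl (heq_of_eq ?_)⟩
        have hlt : s 0 < s 1 := s.strictMono (by decide)
        have h0 : s 0 = 0 := by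
          generalize s 0 = x, s 1 = y at hlt; revert x y; decide
        have h1 : s 1 = 1 := by
          generalize s 0 = x, s 1 = y at hlt; revert x y; decide
        refine RelEmbedding.ext fun x => ?_
        fin_cases x
        exacts [h0.symm, h1.symm]
  rw [← h.sum_comp, Fintype.sum_option, Fin.sum_univ_two, add_comm]
  rfl

theorem whitney_vertexFace {n : ℕ} (i : Fin (n + 1)) :
    whitney (k := k) (vertexFace i).2 = ofPoly (bary k n i) := by
  have h : ∀ s : Fin (0 + 1) → Fin (n + 1), whitney (k := k) s = ofPoly (bary k n (s 0)) :=
    fun s => by simp [whitney]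
  exact h _

/-- The identity `s d = E ∫ - Id` of the Dupont contraction on polynomials: `s(df)` is the affine
interpolation of `f` at the vertices minus `f`. -/
theorem dupont_dPoly [CharZero k] {n : ℕ} (f : MvPolynomial (Fin n) k) :
    dupont k n (dPoly f) =
      ofPoly (∑ i, evalVertex i f • bary k n i - f) := by
  rw [dupont_apply, sum_face_eq_sum_vertexFace]
  · have h : ∀ i, whitney (vertexFace i).2 * (List.ofFn fun j =>
        coneOp k n ((vertexFace i).2 j)).reverse.prod (dPoly f) =
        ofPoly (bary k n i * (MvPolynomial.C (evalVertex i f) - f)) := fun i => by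
      rw [whitney_vertexFace, ofPoly_mul, ← coneOp_dPoly]
      rfl
    rw [Finset.sum_congr rfl fun i _ => h i, ← ofPoly_sum]
    congr 1
    simp only [mul_sub, Finset.sum_sub_distrib]
    rw [← Finset.sum_mul, sum_bary, one_mul]
    simp only [MvPolynomial.smul_eq_C_mul, mul_comm (bary k n _)]
  · intro s hs
    rw [ofFn_coneOp_reverse, coneOp_prod_eq_zero _ (dPoly_mem_formGr f), mul_zero]
    have := Fin.pos_of_ne_zero hs
    simpa using this

theorem dPoly_fin_one (f : MvPolynomial (Fin 1) k) :
    dPoly f = MvPolynomial.pderiv 0 f ⊗ₜ ExteriorAlgebra.ι k (Pi.single 0 1) :=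
  Fin.sum_univ_one _

/-- Stokes' theorem on the interval. -/
theorem simplexInt_one_dPoly [CharZero k] (f : MvPolynomial (Fin 1) k) :
    simplexInt k 1 (dPoly f) = evalVertex 1 f - evalVertex 0 f := by
  have hdet : ExteriorAlgebra.liftAlternating
      (Pi.single (M := fun i => (Fin 1 → k) [⋀^Fin i]→ₗ[k] k) 1 Matrix.detRowAlternating)
      (ExteriorAlgebra.ι k (Pi.single 0 1)) = 1 := by
    have := ExteriorAlgebra.liftAlternating_apply_ιMulti
      (Pi.single (M := fun i => (Fin 1 → k) [⋀^Fin i]→ₗ[k] k) 1 Matrix.detRowAlternating)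
      (fun _ : Fin 1 => Pi.single 0 1)
    rw [ExteriorAlgebra.ιMulti_apply, List.ofFn_succ, List.ofFn_zero, List.prod_singleton,
      Pi.single_eq_same] at this
    rw [this]
    exact (Matrix.det_fin_one _).trans (Pi.single_eq_same _ _)
  have h : ((MvPolynomial.basisMonomials (Fin 1) k).constr k fun a =>
        ((∏ i, (a i).factorial : ℕ) : k) / (((∑ i, a i) + 1).factorial : k)) ∘ₗ
      (MvPolynomial.pderiv (R := k) (0 : Fin 1)).toLinearMap =
      (evalVertex 1).toLinearMap - (evalVertex 0).toLinearMap := by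
    refine (MvPolynomial.basisMonomials (Fin 1) k).ext fun a => ?_
    have hm : MvPolynomial.monomial (a - Finsupp.single 0 1) (a 0 : k) =
        (a 0 : k) • MvPolynomial.basisMonomials (Fin 1) k (a - Finsupp.single 0 1) := by
      simp [MvPolynomial.smul_monomial]
    simp only [MvPolynomial.coe_basisMonomials, LinearMap.comp_apply, LinearMap.sub_apply,
      AlgHom.toLinearMap_apply, Derivation.coeFn_coe]
    rw [MvPolynomial.pderiv_monomial, one_mul, hm, map_smul, Module.Basis.constr_basis, evalVertex,
      evalVertex, MvPolynomial.aeval_monomial, MvPolynomial.aeval_monomial]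
    rcases h : a 0 with _ | m
    · simp [h, Finsupp.prod_fintype]
    · have h0 : ((m : k) + 1) ≠ 0 := by exact_mod_cast m.succ_ne_zero
      have h1 : (m.factorial : k) ≠ 0 := by exact_mod_cast m.factorial_ne_zero
      simp [h, Finsupp.prod_fintype, Nat.factorial_succ]
      field_simp
  rw [dPoly_fin_one, ← AlgHom.toLinearMap_apply (evalVertex 1), ← AlgHom.toLinearMap_apply,
    ← LinearMap.sub_apply, ← h]
  simp [simplexInt, hdet]

/-! ### Bernoulli polynomials on the interval -/

theorem pderiv_aeval_X (p : Polynomial k) :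
    MvPolynomial.pderiv 0 (Polynomial.aeval (MvPolynomial.X 0 : MvPolynomial (Fin 1) k) p) =
      Polynomial.aeval (MvPolynomial.X (0 : Fin 1)) (Polynomial.derivative p) := by
  rw [Derivation.map_aeval]
  simp

/-- The normalised Bernoulli polynomial `(Bₙ(t) - Bₙ) / n!`. -/
def bernoulliPoly (k : Type u) [Field k] [CharZero k] (n : ℕ) : MvPolynomial (Fin 1) k :=
  (n.factorial : k)⁻¹ • (Polynomial.aeval (MvPolynomial.X 0)
    ((Polynomial.bernoulli n).map (algebraMap ℚ k)) - MvPolynomial.C ((bernoulli n : ℚ) : k))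

variable [CharZero k]

theorem evalVertex_aeval_X (i : Fin 2) (p : Polynomial ℚ) :
    evalVertex i (Polynomial.aeval (MvPolynomial.X (0 : Fin 1)) (p.map (algebraMap ℚ k))) =
      ((p.eval (i.val : ℚ) : ℚ) : k) := by
  rw [← Polynomial.aeval_algHom_apply, Polynomial.aeval_map_algebraMap]
  have : evalVertex i (MvPolynomial.X (0 : Fin 1)) = algebraMap ℚ k (i.val : ℚ) := by
    fin_cases i <;> simp [evalVertex]
  rw [this, Polynomial.aeval_algebraMap_apply]
  simp

theorem evalVertex_zero_bernoulliPoly (n : ℕ) : evalVertex 0 (bernoulliPoly k n) = 0 := by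
  rw [bernoulliPoly, map_smul, map_sub, evalVertex_aeval_X]
  simp [evalVertex]

/-- Except for `n = 1`, the values of `Bₙ(t)` at `0` and at `1` are the same. -/
theorem evalVertex_one_bernoulliPoly {n : ℕ} (hn : n ≠ 1) :
    evalVertex 1 (bernoulliPoly k n) = 0 := by
  rw [bernoulliPoly, map_smul, map_sub, evalVertex_aeval_X]
  simp [evalVertex, bernoulli_eq_bernoulli'_of_ne_one hn]

theorem bernoulliPoly_one : bernoulliPoly k 1 = MvPolynomial.X 0 := by
  have h : (MvPolynomial.C 2⁻¹ + MvPolynomial.C (-1 / 2) : MvPolynomial (Fin 1) k) = 0 := by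
    rw [← map_add]
    norm_num
  simp only [bernoulliPoly, Polynomial.bernoulli_one, bernoulli_one]
  simp [sub_sub, h]

theorem pderiv_bernoulliPoly (n : ℕ) : MvPolynomial.pderiv 0 (bernoulliPoly k (n + 1)) =
    bernoulliPoly k n + MvPolynomial.C (((bernoulli n : ℚ) : k) / (n.factorial : k)) := by
  have h0 : ((n : k) + 1) ≠ 0 := by exact_mod_cast n.succ_ne_zero
  have h1 : (n.factorial : k) ≠ 0 := by exact_mod_cast n.factorial_ne_zero
  rw [bernoulliPoly, Derivation.map_smul, map_sub, MvPolynomial.pderiv_C, sub_zero, pderiv_aeval_X,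
    Polynomial.derivative_map, Polynomial.derivative_bernoulli_add_one]
  simp only [bernoulliPoly, Polynomial.map_mul, Polynomial.map_add, Polynomial.map_natCast,
    Polynomial.map_one, map_mul, map_add, map_natCast, map_one, smul_sub,
    MvPolynomial.smul_eq_C_mul]
  rw [div_eq_inv_mul, map_mul (MvPolynomial.C), sub_add_cancel, ← mul_assoc]
  congr 1
  rw [← map_natCast (MvPolynomial.C), ← map_one (MvPolynomial.C), ← map_add, ← map_mul]
  congr 1
  rw [Nat.factorial_succ]
  push_cast
  field_simp

/-- The one-form `βₙ dt`, where `βₙ = (Bₙ(t) - Bₙ) / n!`. -/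
def bernoulliForm (k : Type u) [Field k] [CharZero k] (n : ℕ) : Om k 1 :=
  bernoulliPoly k n ⊗ₜ ExteriorAlgebra.ι k (Pi.single 0 1)

theorem bernoulliForm_eq (n : ℕ) : bernoulliForm k n =
    dPoly (bernoulliPoly k (n + 1) -
      (((bernoulli n : ℚ) : k) / (n.factorial : k)) • MvPolynomial.X 0) := by
  rw [dPoly_fin_one, map_sub, pderiv_bernoulliPoly, Derivation.map_smul, MvPolynomial.pderiv_X_self,
    MvPolynomial.smul_eq_C_mul, mul_one, add_sub_cancel_right]
  rfl

/-- The values at the endpoints of the primitive of `βₙ dt` that vanishes at `0`. -/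
theorem evalVertex_primitive {n : ℕ} (hn : n ≠ 0) (i : Fin 2) :
    evalVertex i (bernoulliPoly k (n + 1) -
      (((bernoulli n : ℚ) : k) / (n.factorial : k)) • MvPolynomial.X 0) =
      if i = 0 then 0 else -(((bernoulli n : ℚ) : k) / (n.factorial : k)) := by
  rw [map_sub, map_smul]
  fin_cases i
  · change evalVertex 0 _ - _ • evalVertex 0 _ = _
    rw [evalVertex_zero_bernoulliPoly]
    simp [evalVertex]
  · change evalVertex 1 _ - _ • evalVertex 1 _ = _
    rw [evalVertex_one_bernoulliPoly (by omega)]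
    simp [evalVertex]

/-- The Dupont homotopy of the interval shifts the Bernoulli polynomials: `s(βₙ dt) = -βₙ₊₁`. -/
theorem dupont_bernoulliForm {n : ℕ} (hn : n ≠ 0) :
    dupont k 1 (bernoulliForm k n) = -ofPoly (bernoulliPoly k (n + 1)) := by
  rw [bernoulliForm_eq, dupont_dPoly, Fin.sum_univ_two, evalVertex_primitive hn,
    evalVertex_primitive hn]
  have : bary k 1 1 = MvPolynomial.X 0 := rfl
  simp only [this, if_true, zero_smul, zero_add, Fin.isValue, one_ne_zero, if_false]
  rw [neg_smul, sub_sub_eq_add_sub, neg_add_cancel, zero_sub]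
  exact TensorProduct.neg_tmul _ _

theorem simplexInt_bernoulliForm {n : ℕ} (hn : n ≠ 0) :
    simplexInt k 1 (bernoulliForm k n) = -(((bernoulli n : ℚ) : k) / (n.factorial : k)) := by
  rw [bernoulliForm_eq, simplexInt_one_dPoly, evalVertex_primitive hn, evalVertex_primitive hn]
  simp

/-- The homotopy vanishes on the Whitney form `dt`. -/
theorem dupont_dPoly_X : dupont k 1 (dPoly (MvPolynomial.X 0)) = 0 := by
  rw [dupont_dPoly, Fin.sum_univ_two]
  have : bary k 1 1 = MvPolynomial.X 0 := rfl
  simp [this, evalVertex, ofPoly]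

end ExactForms

/-! ### Transfer kernels and filtrations -/

section TransferKernel

variable {k : Type u} [Field k] {W : Type*} [Ring W] [Algebra k W]

/-- The kernel `P_n` evaluated at the first `n` terms of a sequence. -/
def transferSeq (ε h : W →ₗ[k] W) (n : ℕ) (v : ℕ → W) : W :=
  transferKernel ε h n fun j => v j.val

/-- The factors `h P_n` of the kernels, with the convention `h P_1 = Id`, evaluated at the first
`n` terms of a sequence. -/
def transferFactor (ε h : W →ₗ[k] W) (n : ℕ) (v : ℕ → W) : W :=
  if n = 1 then v 0 else h (transferSeq ε h n v)

variable (ε h : W →ₗ[k] W)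

theorem transferSeq_eq (n : ℕ) (v : ℕ → W) : transferSeq ε h n v =
    ∑ a ∈ Finset.range n, if 0 < a then (-1 : k) ^ (a * (n - a + 1)) •
      (transferFactor ε h a (fun j => (ε ^ (n - a + 1)) (v j)) *
        transferFactor ε h (n - a) fun j => v (a + j)) else 0 := by
  rw [transferSeq, transferKernel, Finset.sum_range]
  rfl

variable {ε h}

theorem transferFactor_of_ne_one {n : ℕ} (hn : n ≠ 1) (v : ℕ → W) :
    transferFactor ε h n v = h (transferSeq ε h n v) := if_neg hn

theorem transferSeq_eq_zero {n i : ℕ} {v : ℕ → W} (hi : i < n) (hv : v i = 0) :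
    transferSeq ε h n v = 0 := by
  induction n using Nat.strong_induction_on generalizing v i with
  | _ n ih =>
    have hX : ∀ m < n, ∀ i < m, ∀ v : ℕ → W, v i = 0 → transferFactor ε h m v = 0 := by
      intro m hm i hi v hv
      rw [transferFactor]
      split_ifs with h1
      · obtain rfl : i = 0 := by omega
        exact hv
      · rw [ih m hm hi hv, map_zero]
    rw [transferSeq_eq]
    refine Finset.sum_eq_zero fun a ha => ?_
    rw [Finset.mem_range] at ha
    split_ifs with ha0
    · rcases lt_or_ge i a with hia | hia
      · rw [hX a ha i hia _ (by simp only [hv, map_zero]), zero_mul, smul_zero]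
      · rw [hX (n - a) (by omega) (i - a) (by omega) (fun j => v (a + j))
          (by simpa only [Nat.add_sub_cancel' hia]), mul_zero, smul_zero]
    · rfl

theorem transferSeq_of_homotopy_eq_zero {n : ℕ} (hn : 2 < n) (v : ℕ → W) :
    transferSeq ε (0 : W →ₗ[k] W) n v = 0 := by
  rw [transferSeq_eq]
  refine Finset.sum_eq_zero fun a ha => ?_
  rw [Finset.mem_range] at ha
  split_ifs with ha0
  · by_cases h1 : a = 1
    · rw [transferFactor_of_ne_one (n := n - a) (by omega), LinearMap.zero_apply, mul_zero,
        smul_zero]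
    · rw [transferFactor_of_ne_one h1, LinearMap.zero_apply, zero_mul, smul_zero]
  · rfl

variable {F : ℕ → Submodule k W}

theorem pow_apply_mem (hε : ∀ i, ∀ x ∈ F i, ε x ∈ F i) (m i : ℕ) {x : W} (hx : x ∈ F i) :
    (ε ^ m) x ∈ F i := by
  induction m with
  | zero => exact hx
  | succ m ih => rw [pow_succ', Module.End.mul_apply]; exact hε i _ ih

/-- If the homotopy lowers a multiplicative filtration by one, then changing arguments in `F 1` by
elements of `F 0` changes the values of the kernels, which are in `F 2`, by elements of `F 1`. -/
theorem transferSeq_mem_and_sub_mem (hmul : ∀ i j, ∀ x ∈ F i, ∀ y ∈ F j, x * y ∈ F (i + j))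
    (hε : ∀ i, ∀ x ∈ F i, ε x ∈ F i) (hh : ∀ i, ∀ x ∈ F (i + 1), h x ∈ F i) (n : ℕ)
    {v w : ℕ → W} (hv : ∀ j, v j ∈ F 1) (hw : ∀ j, w j ∈ F 1) (hvw : ∀ j, v j - w j ∈ F 0) :
    transferSeq ε h n v ∈ F 2 ∧ transferSeq ε h n v - transferSeq ε h n w ∈ F 1 := by
  induction n using Nat.strong_induction_on generalizing v w with
  | _ n ih =>
    have hX : ∀ m < n, ∀ v w : ℕ → W, (∀ j, v j ∈ F 1) → (∀ j, w j ∈ F 1) →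
        (∀ j, v j - w j ∈ F 0) → transferFactor ε h m v ∈ F 1 ∧
          transferFactor ε h m v - transferFactor ε h m w ∈ F 0 := by
      intro m hm v w hv hw hvw
      rw [transferFactor, transferFactor]
      split_ifs
      · exact ⟨hv 0, hvw 0⟩
      · rw [← map_sub]
        exact ⟨hh 1 _ (ih m hm hv hw hvw).1, hh 0 _ (ih m hm hv hw hvw).2⟩
    have hεv : ∀ m j, (ε ^ m) (v j) ∈ F 1 := fun m j => pow_apply_mem hε m 1 (hv j)
    have hεw : ∀ m j, (ε ^ m) (w j) ∈ F 1 := fun m j => pow_apply_mem hε m 1 (hw j)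
    have hεvw : ∀ m j, (ε ^ m) (v j) - (ε ^ m) (w j) ∈ F 0 := fun m j => by
      rw [← map_sub]
      exact pow_apply_mem hε m 0 (hvw j)
    rw [transferSeq_eq, transferSeq_eq, ← Finset.sum_sub_distrib]
    refine ⟨Submodule.sum_mem _ fun a ha => ?_, Submodule.sum_mem _ fun a ha => ?_⟩
    · rw [Finset.mem_range] at ha
      split_ifs with ha0
      · exact Submodule.smul_mem _ _ (hmul 1 1 _ (hX a ha _ _ (hεv _) (hεw _) (hεvw _)).1 _
          (hX (n - a) (by omega) _ _ (fun j => hv _) (fun j => hw _) (fun j => hvw _)).1)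
      · exact zero_mem _
    · rw [Finset.mem_range] at ha
      split_ifs with ha0
      · have h1 := hX a ha _ _ (hεv (n - a + 1)) (hεw (n - a + 1)) (hεvw (n - a + 1))
        have h2 := hX (n - a) (by omega) (fun j => v (a + j)) (fun j => w (a + j))
          (fun j => hv _) (fun j => hw _) (fun j => hvw _)
        have h3 := hX a ha _ _ (hεw (n - a + 1)) (hεw (n - a + 1)) (fun j => by
          rw [sub_self]; exact zero_mem _)
        rw [← smul_sub]
        refine Submodule.smul_mem _ _ ?_
        have := add_mem (hmul 0 1 _ h1.2 _ h2.1) (hmul 1 0 _ h3.1 _ h2.2)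
        rwa [sub_mul, mul_sub, sub_add_sub_cancel] at this
      · rw [sub_self]; exact zero_mem _

theorem transferSeq_two (v : ℕ → W) (hεε : ε (ε (v 0)) = v 0) :
    transferSeq ε h 2 v = v 0 * v 1 := by
  rw [transferSeq_eq, Finset.sum_range_succ, Finset.sum_range_one]
  simp [transferFactor, pow_two, hεε]

/-- The kernel with its two outermost terms split off. -/
theorem transferSeq_split (hεε : ∀ x, ε (ε x) = x) (m : ℕ) (v : ℕ → W) :
    transferSeq ε h (m + 3) v =
      (∑ a ∈ Finset.range m, (-1 : k) ^ ((a + 2) * (m + 3 - (a + 2) + 1)) •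
        (transferFactor ε h (a + 2) (fun j => (ε ^ (m + 3 - (a + 2) + 1)) (v j)) *
          transferFactor ε h (m + 3 - (a + 2)) fun j => v (a + 2 + j))) +
      (-1 : k) ^ (m + 3) • ((ε ^ (m + 3)) (v 0) * transferFactor ε h (m + 2) fun j => v (1 + j)) +
      transferFactor ε h (m + 2) v * v (m + 2) := by
  have h2 : (ε ^ 2 : Module.End k W) = 1 := LinearMap.ext fun x => by
    rw [pow_two, Module.End.mul_apply, hεε, Module.End.one_apply]
  have h3 : m + 3 - (m + 2) = 1 := by omega
  rw [transferSeq_eq, Finset.sum_range_succ, Finset.sum_range_succ', Finset.sum_range_succ']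
  have h4 : ((-1 : k) ^ (m + 2)) ^ 2 = 1 := by
    rw [← pow_mul, mul_comm, pow_mul, neg_one_sq, one_pow]
  simp only [lt_irrefl, if_false, add_zero, Nat.succ_pos', if_true, h3]
  congr 1
  · congr 1
    simp [transferFactor]
  · simp [transferFactor, h2, h4, pow_mul]

/-- Suppose that the products of two elements of `D` vanish and that the homotopy kills `F 0`.
Then, modulo `F 0`, only the two outermost terms contribute to the kernel at arguments
`d j + f j` with `d j ∈ D` and `f j ∈ F 0`. -/
theorem transferFactor_mem_and_transferSeq_sub_mem {D : Submodule k W}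
    (hmul : ∀ i j, ∀ x ∈ F i, ∀ y ∈ F j, x * y ∈ F (i + j))
    (hε : ∀ i, ∀ x ∈ F i, ε x ∈ F i) (hεε : ∀ x, ε (ε x) = x)
    (hh : ∀ i, ∀ x ∈ F (i + 1), h x ∈ F i) (hh0 : ∀ x ∈ F 0, h x = 0)
    (hD : D ≤ F 1) (hεD : ∀ x ∈ D, ε x = -x) (hDD : ∀ x ∈ D, ∀ y ∈ D, x * y = 0)
    {n : ℕ} (hn : 2 ≤ n) {d f : ℕ → W} (hd : ∀ j, d j ∈ D) (hf : ∀ j, f j ∈ F 0) :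
    transferFactor ε h n (d + f) ∈ F 0 ∧ (2 < n → transferSeq ε h n (d + f) -
      (d 0 * transferFactor ε h (n - 1) (fun j => d (1 + j) + f (1 + j)) +
        transferFactor ε h (n - 1) (d + f) * d (n - 1)) ∈ F 0) := by
  have hεpow : ∀ m, ∀ x ∈ D, (ε ^ m) x = (-1 : k) ^ m • x := by
    intro m x hx
    induction m with
    | zero => simp
    | succ m ih => rw [pow_succ', Module.End.mul_apply, ih, map_smul, hεD x hx, pow_succ, mul_smul,
        neg_one_smul]
  induction n using Nat.strong_induction_on generalizing d f with
  | _ n ih =>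
    -- The claim on the kernel follows from the claim on factors with fewer arguments.
    have key : 2 < n → transferSeq ε h n (d + f) -
        (d 0 * transferFactor ε h (n - 1) (fun j => d (1 + j) + f (1 + j)) +
          transferFactor ε h (n - 1) (d + f) * d (n - 1)) ∈ F 0 := by
      intro hn2
      obtain ⟨m, rfl⟩ : ∃ m, n = m + 3 := ⟨n - 3, by omega⟩
      have hX : ∀ a, 2 ≤ a → a < m + 3 → ∀ (r s : ℕ),
          transferFactor ε h a (fun j => (ε ^ r) ((d + f) (s + j))) ∈ F 0 := by
        intro a ha ham r s
        have := (ih a ham ha (d := fun j => (ε ^ r) (d (s + j)))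
          (f := fun j => (ε ^ r) (f (s + j))) (fun j => by
            rw [hεpow r _ (hd _)]; exact Submodule.smul_mem _ _ (hd _))
          (fun j => pow_apply_mem hε r 0 (hf _))).1
        convert this using 2
        funext j
        simp
      have hsum : ∑ a ∈ Finset.range m, (-1 : k) ^ ((a + 2) * (m + 3 - (a + 2) + 1)) •
          (transferFactor ε h (a + 2) (fun j => (ε ^ (m + 3 - (a + 2) + 1)) ((d + f) j)) *
            transferFactor ε h (m + 3 - (a + 2)) fun j => (d + f) (a + 2 + j)) ∈ F 0 := by
        refine Submodule.sum_mem _ fun a ha => Submodule.smul_mem _ _ ?_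
        rw [Finset.mem_range] at ha
        have h1 := hX (a + 2) (by omega) (by omega) (m + 3 - (a + 2) + 1) 0
        have h2 := hX (m + 3 - (a + 2)) (by omega) (by omega) 0 (a + 2)
        simp only [zero_add] at h1
        exact hmul 0 0 _ h1 _ h2
      have h1 := hX (m + 2) (by omega) (by omega) 0 1
      have h2 := hX (m + 2) (by omega) (by omega) 0 0
      simp only [zero_add] at h2
      have hfst : (-1 : k) ^ (m + 3) • ((ε ^ (m + 3)) ((d + f) 0) *
            transferFactor ε h (m + 2) fun j => (d + f) (1 + j)) -
          d 0 * transferFactor ε h (m + 2) (fun j => (d + f) (1 + j)) ∈ F 0 := by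
        have hs : (-1 : k) ^ (m + 3) * (-1 : k) ^ (m + 3) = 1 := by
          rw [← mul_pow]; simp
        rw [Pi.add_apply, map_add, hεpow _ _ (hd 0), add_mul, smul_add, smul_mul_assoc, smul_smul,
          hs, one_smul, add_sub_cancel_left]
        exact Submodule.smul_mem _ _ (hmul 0 0 _ (pow_apply_mem hε _ 0 (hf 0)) _ h1)
      have hlst := hmul 0 0 _ h2 _ (hf (m + 2))
      rw [transferSeq_split hεε]
      convert add_mem (add_mem hsum hfst) hlst using 1
      change _ - (_ + transferFactor ε h (m + 2) (d + f) * d (m + 2)) = _ + _ +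
        transferFactor ε h (m + 2) (d + f) * f (m + 2)
      rw [Pi.add_apply d f (m + 2), mul_add]
      simp only [Pi.add_apply, show m + 3 - 1 = m + 2 from rfl]
      abel
    refine ⟨?_, key⟩
    rw [transferFactor_of_ne_one (by omega)]
    rcases Nat.lt_or_eq_of_le hn with h2 | rfl
    · have h1 := (ih (n - 1) (by omega) (by omega) (fun j => hd (1 + j)) (fun j => hf (1 + j))).1
      have h2' := (ih (n - 1) (by omega) (by omega) hd hf).1
      have := hh0 _ (key h2)
      rw [map_sub, sub_eq_zero] at this
      rw [this]
      exact hh 0 _ (add_mem (hmul 1 0 _ (hD (hd 0)) _ h1) (hmul 0 1 _ h2' _ (hD (hd _))))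
    · rw [transferSeq_two _ (hεε _), Pi.add_apply, Pi.add_apply, mul_add, add_mul,
        hDD _ (hd 0) _ (hd 1), zero_add, add_mul, map_add, map_add,
        hh0 _ (hmul 0 0 _ (hf 0) _ (hf 1)), add_zero]
      exact add_mem (hh 0 _ (hmul 0 1 _ (hf 0) _ (hD (hd 1))))
        (hh 0 _ (hmul 1 0 _ (hD (hd 0)) _ (hf 1)))

end TransferKernel

/-! ### Forms with values in a cosimplicial algebra -/

namespace CosimplicialCDGA

variable {k : Type u} [Field k] (A : CosimplicialObject (CDGA.{v} k))

/-- The element `ω ⊗ a` of `Ω(n) ⊗ A^{n,•}`. -/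
def formTmul {n : ℕ} (ω : Om k n) (a : lvl A n) : OmA A n :=
  GradedTensorProduct.tmul k (𝒜 := formGr k (Fin n)) (ℬ := (A.obj ⦋n⦌).gr) ω a

variable {A} {n : ℕ}

theorem formTmul_zero (ω : Om k n) : formTmul A ω 0 = 0 := tmul_zero _ ω

theorem zero_formTmul (a : lvl A n) : formTmul A 0 a = 0 := zero_tmul _ a

theorem formTmul_add (ω : Om k n) (a b : lvl A n) :
    formTmul A ω (a + b) = formTmul A ω a + formTmul A ω b := tmul_add ω a b

theorem smul_formTmul (c : k) (ω : Om k n) (a : lvl A n) :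
    formTmul A (c • ω) a = c • formTmul A ω a := (smul_tmul' c ω a).symm

theorem formTmul_smul (c : k) (ω : Om k n) (a : lvl A n) :
    formTmul A ω (c • a) = c • formTmul A ω a := tmul_smul c ω a

theorem neg_formTmul (ω : Om k n) (a : lvl A n) :
    formTmul A (-ω) a = -formTmul A ω a := neg_tmul ω a

theorem formTmul_sub (ω : Om k n) (a b : lvl A n) :
    formTmul A ω (a - b) = formTmul A ω a - formTmul A ω b := tmul_sub ω a b

theorem sub_formTmul (ω η : Om k n) (a : lvl A n) :
    formTmul A (ω - η) a = formTmul A ω a - formTmul A η a := sub_tmul ω η a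

/-- The Koszul sign rule for products in `Ω(n) ⊗ A^{n,•}`. -/
theorem formTmul_mul_formTmul {p q : ℕ} (ω : Om k n) {a : lvl A n} (ha : a ∈ bideg A n q)
    {ω' : Om k n} (hω' : ω' ∈ formGr k (Fin n) p) (a' : lvl A n) :
    formTmul A ω a * formTmul A ω' a' = (-1 : k) ^ (q * p) • formTmul A (ω * ω') (a * a') := by
  have h := GradedTensorProduct.tmul_coe_mul_coe_tmul (R := k) (formGr k (Fin n)) (A.obj ⦋n⦌).gr ω
    (⟨a, ha⟩ : (A.obj ⦋n⦌).gr q) (⟨ω', hω'⟩ : formGr k (Fin n) p) a'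
  refine h.trans ?_
  rcases Nat.even_or_odd (q * p) with h | h
  · rw [h.neg_one_pow, h.neg_one_pow, one_smul, one_smul]
    rfl
  · rw [h.neg_one_pow, h.neg_one_pow, Units.neg_smul, one_smul, neg_smul, one_smul]
    rfl

theorem homotopyOp_formTmul (ω : Om k n) (a : lvl A n) :
    homotopyOp A n (formTmul A ω a) = formTmul A (dupont k n ω) a := rfl

theorem signOp_formTmul {p q : ℕ} {ω : Om k n} (hω : ω ∈ formGr k (Fin n) p) {a : lvl A n}
    (ha : a ∈ bideg A n q) :
    signOp A n (formTmul A ω a) = ((-1 : k) ^ p * (-1 : k) ^ q) • formTmul A ω a := by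
  change formTmul A (gradeSign _ ω) (gradeSign _ a) = _
  rw [gradeSign_apply _ hω, gradeSign_apply _ ha]
  rw [smul_formTmul, formTmul_smul, smul_smul]

theorem gradeSign_gradeSign {R : Type*} [Ring R] [Algebra k R] (𝒜 : ℕ → Submodule k R)
    [GradedAlgebra 𝒜] (x : R) : gradeSign 𝒜 (gradeSign 𝒜 x) = x := by
  induction x using DirectSum.Decomposition.inductionOn 𝒜 with
  | zero => simp
  | homogeneous x =>
    rw [gradeSign_apply 𝒜 x.2, map_smul, gradeSign_apply 𝒜 x.2, smul_smul, ← mul_pow]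
    simp
  | add x y hx hy => rw [map_add, map_add, hx, hy]

theorem signOp_signOp (x : OmA A n) : signOp A n (signOp A n x) = x := by
  have h : ∀ y : Om k n ⊗[k] lvl A n,
      TensorProduct.map (gradeSign (formGr k (Fin n))) (gradeSign (A.obj ⦋n⦌).gr)
        (TensorProduct.map (gradeSign (formGr k (Fin n))) (gradeSign (A.obj ⦋n⦌).gr) y) = y := by
    intro y
    induction y using TensorProduct.induction_on with
    | zero => simp
    | tmul ω a => rw [map_tmul, map_tmul, gradeSign_gradeSign, gradeSign_gradeSign]
    | add x y hx hy => rw [map_add, map_add, hx, hy]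
  exact h x

variable (A n) in
/-- The elements of `Ω(n) ⊗ A^{n,•}` of form degree at most `j`. -/
def formFiltration (j : ℕ) : Submodule k (OmA A n) :=
  Submodule.span k {x | ∃ i ≤ j, ∃ q, ∃ ω ∈ formGr k (Fin n) i, ∃ a ∈ bideg A n q,
    formTmul A ω a = x}

theorem formFiltration_le {j : ℕ} {S : Submodule k (OmA A n)}
    (h : ∀ i ≤ j, ∀ q, ∀ ω ∈ formGr k (Fin n) i, ∀ a ∈ bideg A n q, formTmul A ω a ∈ S) :
    formFiltration A n j ≤ S := by
  refine Submodule.span_le.mpr ?_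
  rintro _ ⟨i, hi, q, ω, hω, a, ha, rfl⟩
  exact h i hi q ω hω a ha

theorem formTmul_mem_formFiltration {i j : ℕ} (hij : i ≤ j) {ω : Om k n}
    (hω : ω ∈ formGr k (Fin n) i) (a : lvl A n) : formTmul A ω a ∈ formFiltration A n j := by
  induction a using DirectSum.Decomposition.inductionOn (A.obj ⦋n⦌).gr with
  | zero => rw [formTmul_zero]; exact zero_mem _
  | homogeneous a => exact Submodule.subset_span ⟨i, hij, _, ω, hω, a, a.2, rfl⟩
  | add a b ha hb =>
    rw [formTmul_add]
    exact add_mem ha hb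

theorem mul_mem_formFiltration (i j : ℕ) :
    ∀ x ∈ formFiltration A n i, ∀ y ∈ formFiltration A n j, x * y ∈ formFiltration A n (i + j) := by
  intro x hx y hy
  refine formFiltration_le (S := (formFiltration A n (i + j)).comap (LinearMap.mulRight k y))
    (fun i' hi q ω hω a ha => ?_) hx
  refine formFiltration_le (S := (formFiltration A n (i + j)).comap
    (LinearMap.mulLeft k (formTmul A ω a))) (fun j' hj q' ω' hω' a' ha' => ?_) hy
  rw [Submodule.mem_comap, LinearMap.mulLeft_apply, formTmul_mul_formTmul ω ha hω']
  exact Submodule.smul_mem _ _ (formTmul_mem_formFiltration (add_le_add hi hj)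
    (mul_mem_formGr hω hω') _)

theorem signOp_mem_formFiltration (i : ℕ) :
    ∀ x ∈ formFiltration A n i, signOp A n x ∈ formFiltration A n i := by
  intro x hx
  refine formFiltration_le (S := (formFiltration A n i).comap (signOp A n))
    (fun i' hi q ω hω a ha => ?_) hx
  rw [Submodule.mem_comap, signOp_formTmul hω ha]
  exact Submodule.smul_mem _ _ (formTmul_mem_formFiltration hi hω a)

theorem homotopyOp_mem_formFiltration (i : ℕ) :
    ∀ x ∈ formFiltration A n (i + 1), homotopyOp A n x ∈ formFiltration A n i := by
  intro x hx
  refine formFiltration_le (S := (formFiltration A n i).comap (homotopyOp A n))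
    (fun i' hi q ω hω a ha => ?_) hx
  rw [Submodule.mem_comap, homotopyOp_formTmul]
  rcases i' with _ | i'
  · rw [dupont_eq_zero hω, zero_formTmul]
    exact zero_mem _
  · exact formTmul_mem_formFiltration (by omega) (dupont_mem_formGr hω) a

theorem homotopyOp_eq_zero : ∀ x ∈ formFiltration A n 0, homotopyOp A n x = 0 := by
  intro x hx
  refine formFiltration_le (S := LinearMap.ker (homotopyOp A n))
    (fun i' hi q ω hω a ha => ?_) hx
  obtain rfl : i' = 0 := by omega
  rw [LinearMap.mem_ker, homotopyOp_formTmul, dupont_eq_zero hω, zero_formTmul]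

variable (A) in
theorem homotopyOp_zero : homotopyOp A 0 = 0 := by
  rw [homotopyOp, dupont_zero, LinearMap.rTensor_zero]
  exact map_zero _

variable (A) in
/-- The coefficient of the top-dimensional face in the integral of a form. -/
def topCoeff (p : ℕ) : OmA A p →ₗ[k] lvl A p :=
  (TensorProduct.lid k (lvl A p)).toLinearMap ∘ₗ
    (LinearMap.proj (topFace p) : NC k p →ₗ[k] k).rTensor (lvl A p) ∘ₗ intOp A p

theorem topCoeff_formTmul (p : ℕ) (ω : Om k p) (a : lvl A p) :
    topCoeff A p (formTmul A ω a) = simplexInt k p ω • a := by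
  have h : topCoeff A p (formTmul A ω a) =
      simplexInt k p (simplexPullback k (id : Fin (p + 1) → _) ω) • a := rfl
  rw [h, simplexPullback_id]

theorem topCoeff_eq_zero {p j : ℕ} (hj : j < p) {x : OmA A p} (hx : x ∈ formFiltration A p j) :
    topCoeff A p x = 0 := by
  refine formFiltration_le (S := LinearMap.ker (topCoeff A p)) (fun i hi q ω hω a ha => ?_) hx
  rw [LinearMap.mem_ker, topCoeff_formTmul, simplexInt_eq_zero (by omega) hω, zero_smul]

theorem totMul_apply (l p : ℕ) (a : ℕ → Cochain A) :
    totMul A l (fun r => a r) p = topCoeff A p (transferSeq (signOp A p) (homotopyOp A p) l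
      fun r => inclOp A p (psi A (a r) p)) := rfl

/-- The structure map `A^{p,•} → A^{n,•}` of a `p`-dimensional face of the `n`-simplex. -/
abbrev faceMap (s : Face n) : lvl A s.1.val →ₐ[k] lvl A n :=
  CDGA.algHom (A.map (SimplexCategory.Hom.mk (a := ⦋s.1.val⦌) (b := ⦋n⦌) s.2.toOrderHom))

/-- The image of a cochain in `Ω(n) ⊗ A^{n,•}` as a combination of Whitney forms. -/
theorem inclOp_psi (a : Cochain A) : inclOp A n (psi A a n) =
    ∑ s : Face n, formTmul A (whitney s.2) (faceMap s (a s.1.val)) := by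
  rw [psi, map_sum]
  refine Finset.sum_congr rfl fun s _ => ?_
  have : whitneyMap k n (Pi.single s 1) = whitney s.2 := by
    rw [whitneyMap, Fintype.linearCombination_apply_single, one_smul]
  rw [← this]
  rfl

theorem inclOp_psi_mem_formFiltration {j : ℕ} {a : Cochain A} (ha : ∀ p, j < p → a p = 0) :
    inclOp A n (psi A a n) ∈ formFiltration A n j := by
  rw [inclOp_psi]
  refine Submodule.sum_mem _ fun s _ => ?_
  rcases le_or_gt s.1.val j with h | h
  · exact formTmul_mem_formFiltration h (whitney_mem_formGr _) _
  · rw [ha _ h, map_zero, formTmul_zero]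
    exact zero_mem _

theorem psi_add (a b : Cochain A) : psi A (a + b) n = psi A a n + psi A b n := by
  simp [psi, tmul_add, Finset.sum_add_distrib]

theorem psi_zero : psi A (0 : Cochain A) n = 0 := by
  simp [psi]

end CosimplicialCDGA

/-! ### Products with one factor omitted -/

/-- The product `b₀ ⋯ (omit bⱼ) ⋯ bₗ₋₁` of the first `l` terms of a sequence. -/
def prodOmit {R : Type*} [Monoid R] (l j : ℕ) (b : ℕ → R) : R :=
  ((List.ofFn fun i : Fin l => b i).eraseIdx j).prod

section ProdOmit

variable {R : Type*} [Monoid R]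

theorem prodOmit_succ_succ (l j : ℕ) (b : ℕ → R) :
    prodOmit (l + 1) (j + 1) b = b 0 * prodOmit l j fun i => b (1 + i) := by
  simp [prodOmit, List.ofFn_succ, add_comm]

theorem prodOmit_succ {l j : ℕ} (hj : j < l) (b : ℕ → R) :
    prodOmit (l + 1) j b = prodOmit l j b * b l := by
  rw [prodOmit, List.ofFn_succ', List.concat_eq_append,
    List.eraseIdx_append_of_lt_length (by simpa using hj)]
  simp [prodOmit]

theorem prodOmit_one (b : ℕ → R) : prodOmit 1 0 b = 1 := by
  simp [prodOmit]

end ProdOmit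

/-- Pascal's rule, in the form in which the two outermost terms of a kernel combine. -/
theorem sum_choose_smul_pascal {k M : Type*} [Field k] [AddCommGroup M] [Module k M] (m : ℕ)
    (η : ℕ → k) (T : ℕ → M) :
    ∑ j ∈ Finset.range (m + 1),
        ((-1 : k) ^ m * η (1 + j) ^ (m - j) * (m.choose j : k)) • T (j + 1) +
      ∑ j ∈ Finset.range (m + 1), ((-1 : k) ^ m * η j ^ (m - j) * (m.choose j : k)) • η j • T j =
    -∑ j ∈ Finset.range (m + 2),
      ((-1 : k) ^ (m + 1) * η j ^ (m + 1 - j) * ((m + 1).choose j : k)) • T j := by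
  -- The additional term vanishes because its binomial coefficient is zero.
  have h : ∑ j ∈ Finset.range (m + 1),
        ((-1 : k) ^ m * η j ^ (m - j) * (m.choose j : k)) • η j • T j =
      ∑ j ∈ Finset.range (m + 2),
        ((-1 : k) ^ m * η j ^ (m - j) * (m.choose j : k)) • η j • T j := by
    rw [Finset.sum_range_succ _ (m + 1)]
    simp
  rw [h, Finset.sum_range_succ' _ (m + 1), Finset.sum_range_succ' _ (m + 1), ← add_assoc,
    ← Finset.sum_add_distrib, neg_add, ← Finset.sum_neg_distrib]
  congr 1
  · refine Finset.sum_congr rfl fun j hj => ?_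
    rw [smul_smul, ← add_smul, ← neg_smul, Nat.choose_succ_succ, add_comm 1 j,
      Nat.add_sub_add_right]
    congr 1
    rcases Nat.lt_or_eq_of_le (Nat.lt_succ_iff.mp (Finset.mem_range.mp hj)) with hj | rfl
    · obtain ⟨r, rfl⟩ := Nat.exists_eq_add_of_lt hj
      rw [show j + r + 1 - j = r + 1 by omega, show j + r + 1 - (j + 1) = r by omega]
      push_cast
      ring
    · simp [pow_succ]
  · rw [smul_smul, ← neg_smul]
    congr 1
    simp [pow_succ]
    ring

namespace CosimplicialCDGA

variable {k : Type u} [Field k] {A : CosimplicialObject (CDGA.{v} k)}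

theorem prodOmit_mem {n : ℕ} (l j : ℕ) {b : ℕ → lvl A n} (hb : ∀ i, b i ∈ bideg A n 0) :
    prodOmit l j b ∈ bideg A n 0 := by
  have h : ∀ L : List (lvl A n), (∀ x ∈ L, x ∈ bideg A n 0) → L.prod ∈ bideg A n 0 := by
    intro L hL
    induction L with
    | nil => exact SetLike.GradedOne.one_mem
    | cons x L ih =>
      rw [List.prod_cons]
      exact SetLike.GradedMul.mul_mem (i := 0) (j := 0) (hL x (by simp))
        (ih fun y hy => hL y (by simp [hy]))
  refine h _ fun x hx => ?_
  obtain ⟨i, rfl⟩ := (List.mem_ofFn' _ _).mp (List.mem_of_mem_eraseIdx hx)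
  exact hb i

theorem mul_comm_of_bideg_zero {n q : ℕ} {a b : lvl A n} (ha : a ∈ bideg A n q)
    (hb : b ∈ bideg A n 0) : a * b = b * a := by
  rw [(A.obj ⦋n⦌).comm ha hb, mul_zero, pow_zero, one_smul]

/-! ### The transferred operations in cosimplicial degree one -/

section DegreeOne

/-- The sum `∑ⱼ (-1)^{l-1} (-1)^{qⱼ (l-1-j)} binom(l-1, j) ω ⊗ b₀ ⋯ (omit bⱼ) ⋯ bₗ₋₁ gⱼ`, in which
`qⱼ` is the degree of `gⱼ`. -/
def binomialSum (ω : Om k 1) (l : ℕ) (b g : ℕ → lvl A 1) (q : ℕ → ℕ) : OmA A 1 :=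
  ∑ j ∈ Finset.range l, ((-1 : k) ^ (l - 1) * ((-1 : k) ^ q j) ^ (l - 1 - j) *
    ((l - 1).choose j : k)) • formTmul A ω (prodOmit l j b * g j)

variable (k) in
/-- The form `dt` on the interval. -/
def dt : Om k 1 := dPoly (MvPolynomial.X 0)

variable (A) in
/-- The elements `dt ⊗ b` with `b ∈ A^{1,0}`. -/
def dtSubmodule : Submodule k (OmA A 1) :=
  Submodule.span k {x | ∃ b ∈ bideg A 1 0, formTmul A (dt k) b = x}

theorem mem_dtSubmodule {x : OmA A 1} (hx : x ∈ dtSubmodule A) :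
    ∃ b ∈ bideg A 1 0, formTmul A (dt k) b = x := by
  induction hx using Submodule.span_induction with
  | mem x hx => exact hx
  | zero => exact ⟨0, zero_mem _, formTmul_zero _⟩
  | add x y _ _ hx hy =>
    obtain ⟨b, hb, rfl⟩ := hx
    obtain ⟨c, hc, rfl⟩ := hy
    exact ⟨b + c, add_mem hb hc, formTmul_add _ _ _⟩
  | smul r x _ hx =>
    obtain ⟨b, hb, rfl⟩ := hx
    exact ⟨r • b, Submodule.smul_mem _ _ hb, formTmul_smul _ _ _⟩

theorem dt_mem_formGr : dt k ∈ formGr k (Fin 1) 1 := dPoly_mem_formGr _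

theorem dtSubmodule_le : dtSubmodule A ≤ formFiltration A 1 1 := fun x hx => by
  obtain ⟨b, -, rfl⟩ := mem_dtSubmodule hx
  exact formTmul_mem_formFiltration le_rfl dt_mem_formGr b

theorem signOp_dtSubmodule : ∀ x ∈ dtSubmodule A, signOp A 1 x = -x := fun x hx => by
  obtain ⟨b, hb, rfl⟩ := mem_dtSubmodule hx
  rw [signOp_formTmul dt_mem_formGr hb, pow_one, pow_zero, mul_one, neg_smul, one_smul]

theorem mul_dtSubmodule : ∀ x ∈ dtSubmodule A, ∀ y ∈ dtSubmodule A, x * y = 0 :=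
  fun x hx y hy => by
    obtain ⟨b, hb, rfl⟩ := mem_dtSubmodule hx
    obtain ⟨c, -, rfl⟩ := mem_dtSubmodule hy
    rw [formTmul_mul_formTmul _ hb dt_mem_formGr, dt, dPoly_mul_self, zero_formTmul, smul_zero]

variable [CharZero k]

theorem dt_mul_bernoulliPoly (n : ℕ) : dt k * ofPoly (bernoulliPoly k n) = bernoulliForm k n := by
  rw [dt, dPoly_X, ofPoly, Algebra.TensorProduct.tmul_mul_tmul, one_mul, mul_one]
  rfl

theorem bernoulliPoly_mul_dt (n : ℕ) : ofPoly (bernoulliPoly k n) * dt k = bernoulliForm k n := by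
  rw [dt, dPoly_X, ofPoly, Algebra.TensorProduct.tmul_mul_tmul, one_mul, mul_one]
  rfl

variable {b g : ℕ → lvl A 1} {q : ℕ → ℕ}

/-- Pascal's rule for the sums `binomialSum`. -/
theorem binomialSum_pascal (hb : ∀ j, b j ∈ bideg A 1 0) (hg : ∀ j, g j ∈ bideg A 1 (q j)) (m : ℕ) :
    formTmul A (dt k) (b 0) * binomialSum (ofPoly (bernoulliPoly k (m + 1))) (m + 1)
        (fun j => b (1 + j)) (fun j => g (1 + j)) (fun j => q (1 + j)) +
      binomialSum (ofPoly (bernoulliPoly k (m + 1))) (m + 1) b g q * formTmul A (dt k) (b (m + 1)) =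
    -binomialSum (bernoulliForm k (m + 1)) (m + 2) b g q := by
  have hdt : dt k ∈ formGr k (Fin 1) 1 := dPoly_mem_formGr _
  let T : ℕ → OmA A 1 := fun j => formTmul A (bernoulliForm k (m + 1)) (prodOmit (m + 2) j b * g j)
  have hL : ∀ j, formTmul A (dt k) (b 0) * formTmul A (ofPoly (bernoulliPoly k (m + 1)))
      ((prodOmit (m + 1) j fun j => b (1 + j)) * g (1 + j)) = T (j + 1) := fun j => by
    rw [formTmul_mul_formTmul _ (hb 0) (mem_formGr_zero_ofPoly _), mul_zero, pow_zero, one_smul,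
      dt_mul_bernoulliPoly, ← mul_assoc, ← prodOmit_succ_succ, add_comm 1 j]
  have hR : ∀ j < m + 1, formTmul A (ofPoly (bernoulliPoly k (m + 1)))
      (prodOmit (m + 1) j b * g j) * formTmul A (dt k) (b (m + 1)) = (-1 : k) ^ q j • T j :=
    fun j hj => by
      have hmem : prodOmit (m + 1) j b * g j ∈ bideg A 1 (q j) := by
        simpa using SetLike.GradedMul.mul_mem (prodOmit_mem (m + 1) j hb) (hg j)
      rw [formTmul_mul_formTmul _ hmem hdt, mul_one, bernoulliPoly_mul_dt, mul_assoc,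
        mul_comm_of_bideg_zero (hg j) (hb _), ← mul_assoc, ← prodOmit_succ hj]
  refine Eq.trans ?_ (sum_choose_smul_pascal m (fun j => (-1 : k) ^ q j) T)
  rw [binomialSum, binomialSum, Finset.mul_sum, Finset.sum_mul]
  refine congrArg₂ _ (Finset.sum_congr rfl fun j _ => ?_) (Finset.sum_congr rfl fun j hj => ?_)
  · rw [mul_smul_comm, hL]
    rfl
  · rw [smul_mul_assoc, hR j (Finset.mem_range.mp hj)]
    rfl

theorem homotopyOp_binomialSum {n : ℕ} (hn : n ≠ 0) (l : ℕ) :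
    homotopyOp A 1 (binomialSum (bernoulliForm k n) l b g q) =
      -binomialSum (ofPoly (bernoulliPoly k (n + 1))) l b g q := by
  rw [binomialSum, binomialSum, map_sum, ← Finset.sum_neg_distrib]
  refine Finset.sum_congr rfl fun j _ => ?_
  rw [map_smul, homotopyOp_formTmul, dupont_bernoulliForm hn, neg_formTmul, smul_neg]

theorem topCoeff_binomialSum {n : ℕ} (hn : n ≠ 0) (l : ℕ) :
    topCoeff A 1 (binomialSum (bernoulliForm k n) l b g q) =
      -∑ j ∈ Finset.range l, ((-1 : k) ^ (l - 1) * ((-1 : k) ^ q j) ^ (l - 1 - j) *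
        ((l - 1).choose j : k) * (((bernoulli n : ℚ) : k) / (n.factorial : k))) •
          (prodOmit l j b * g j) := by
  rw [binomialSum, map_sum, ← Finset.sum_neg_distrib]
  refine Finset.sum_congr rfl fun j _ => ?_
  rw [map_smul, topCoeff_formTmul, simplexInt_bernoulliForm hn, smul_smul, ← neg_smul, mul_neg]

/-- The elements `dt ⊗ bⱼ`. -/
def dtPart (b : ℕ → lvl A 1) (j : ℕ) : OmA A 1 := formTmul A (dt k) (b j)

/-- The functions `1 ⊗ eⱼ + t ⊗ gⱼ` on the interval. -/
def affinePart (e g : ℕ → lvl A 1) (j : ℕ) : OmA A 1 :=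
  formTmul A 1 (e j) + formTmul A (ofPoly (bernoulliPoly k 1)) (g j)

theorem affinePart_mem (e g : ℕ → lvl A 1) (j : ℕ) :
    affinePart e g j ∈ formFiltration A 1 0 :=
  add_mem (formTmul_mem_formFiltration le_rfl SetLike.GradedOne.one_mem _)
    (formTmul_mem_formFiltration le_rfl (mem_formGr_zero_ofPoly _) _)

/-- The two outermost terms of the kernels for the filtration by form degree on the interval. -/
theorem transferFactor_affine (hb : ∀ j, b j ∈ bideg A 1 0) (e g : ℕ → lvl A 1) {n : ℕ}
    (hn : 2 ≤ n) :
    transferFactor (signOp A 1) (homotopyOp A 1) n (dtPart b + affinePart e g) ∈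
      formFiltration A 1 0 ∧
    (2 < n → transferSeq (signOp A 1) (homotopyOp A 1) n (dtPart b + affinePart e g) -
      (dtPart b 0 * transferFactor (signOp A 1) (homotopyOp A 1) (n - 1)
        (dtPart (fun j => b (1 + j)) + affinePart (fun j => e (1 + j)) (fun j => g (1 + j))) +
      transferFactor (signOp A 1) (homotopyOp A 1) (n - 1) (dtPart b + affinePart e g) *
        dtPart b (n - 1)) ∈ formFiltration A 1 0) := by
  have h := transferFactor_mem_and_transferSeq_sub_mem (k := k) (W := OmA A 1) (ε := signOp A 1)
    (h := homotopyOp A 1) (F := formFiltration A 1) (D := dtSubmodule A)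
    mul_mem_formFiltration signOp_mem_formFiltration signOp_signOp homotopyOp_mem_formFiltration
    homotopyOp_eq_zero dtSubmodule_le signOp_dtSubmodule mul_dtSubmodule hn
    (d := dtPart b) (f := affinePart e g)
    (fun j => Submodule.subset_span ⟨b j, hb j, rfl⟩) (affinePart_mem e g)
  exact h

theorem transferSeq_two_affine (hb : ∀ j, b j ∈ bideg A 1 0) {e : ℕ → lvl A 1}
    (he : ∀ j, e j ∈ bideg A 1 (q j)) (hg : ∀ j, g j ∈ bideg A 1 (q j)) :
    homotopyOp A 1 (transferSeq (signOp A 1) (homotopyOp A 1) 2 (dtPart b + affinePart e g)) =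
      binomialSum (ofPoly (bernoulliPoly k 2)) 2 b g q := by
  have hdd : dtPart b 0 * dtPart b 1 = 0 := mul_dtSubmodule _
    (Submodule.subset_span ⟨b 0, hb 0, rfl⟩) _ (Submodule.subset_span ⟨b 1, hb 1, rfl⟩)
  have hone : (1 : Om k 1) ∈ formGr k (Fin 1) 0 := SetLike.GradedOne.one_mem
  -- The constant functions contribute multiples of `dt`, which the homotopy kills.
  have h1 : homotopyOp A 1 (formTmul A (dt k) (b 0) * formTmul A 1 (e 1)) = 0 := by
    rw [formTmul_mul_formTmul _ (hb 0) hone, mul_one, map_smul, homotopyOp_formTmul, dt,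
      dupont_dPoly_X, zero_formTmul, smul_zero]
  have h2 : homotopyOp A 1 (formTmul A 1 (e 0) * formTmul A (dt k) (b 1)) = 0 := by
    rw [formTmul_mul_formTmul _ (he 0) dt_mem_formGr, one_mul, map_smul, homotopyOp_formTmul, dt,
      dupont_dPoly_X, zero_formTmul, smul_zero]
  have h3 := congrArg (homotopyOp A 1) (binomialSum_pascal hb hg 0)
  rw [map_neg, homotopyOp_binomialSum (n := 0 + 1) (by omega), neg_neg] at h3
  simp only [binomialSum, zero_add, Finset.sum_range_one, prodOmit_one, one_mul, tsub_self,
    pow_zero, Nat.choose_self, Nat.cast_one, one_smul, add_zero] at h3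
  have h4 := homotopyOp_eq_zero _ (mul_mem_formFiltration 0 0 _ (affinePart_mem e g 0) _
    (affinePart_mem e g 1))
  rw [transferSeq_two _ (signOp_signOp _), Pi.add_apply, Pi.add_apply, add_mul, mul_add, mul_add,
    hdd, zero_add, map_add, map_add, h4, add_zero]
  rw [affinePart, affinePart, dtPart, dtPart, mul_add, add_mul, map_add, map_add, h1, h2, zero_add,
    zero_add, ← map_add]
  exact h3

/-- The values of the transfer factors at `dt ⊗ bⱼ + 1 ⊗ eⱼ + t ⊗ gⱼ`: each application of the
homotopy to a product with `dt ⊗ bⱼ` replaces one Bernoulli polynomial by the next. -/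
theorem transferFactor_eq_binomialSum {b e g : ℕ → lvl A 1} {q : ℕ → ℕ}
    (hb : ∀ j, b j ∈ bideg A 1 0) (he : ∀ j, e j ∈ bideg A 1 (q j))
    (hg : ∀ j, g j ∈ bideg A 1 (q j)) (m : ℕ) :
    transferFactor (signOp A 1) (homotopyOp A 1) (m + 2) (dtPart b + affinePart e g) =
      binomialSum (ofPoly (bernoulliPoly k (m + 2))) (m + 2) b g q := by
  induction m generalizing b e g q with
  | zero => exact (transferFactor_of_ne_one (by omega) _).trans (transferSeq_two_affine hb he hg)
  | succ m ih =>
    have h := homotopyOp_eq_zero _ ((transferFactor_affine hb e g (n := m + 3) (by omega)).2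
      (by omega))
    rw [Nat.add_sub_cancel (m + 2) 1, ih hb he hg,
      ih (fun j => hb (1 + j)) (fun j => he (1 + j)) (fun j => hg (1 + j)), map_sub, sub_eq_zero,
      dtPart, dtPart, binomialSum_pascal hb hg (m + 1), map_neg,
      homotopyOp_binomialSum (by omega), neg_neg] at h
    exact (transferFactor_of_ne_one (by omega) _).trans h

/-- The kernels at `dt ⊗ bⱼ + 1 ⊗ eⱼ + t ⊗ gⱼ` up to functions, which have integral zero. -/
theorem transferSeq_add_binomialSum_mem {e : ℕ → lvl A 1}
    (hb : ∀ j, b j ∈ bideg A 1 0) (he : ∀ j, e j ∈ bideg A 1 (q j))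
    (hg : ∀ j, g j ∈ bideg A 1 (q j)) (m : ℕ) :
    transferSeq (signOp A 1) (homotopyOp A 1) (m + 3) (dtPart b + affinePart e g) +
      binomialSum (bernoulliForm k (m + 2)) (m + 3) b g q ∈ formFiltration A 1 0 := by
  have h := (transferFactor_affine hb e g (n := m + 3) (by omega)).2 (by omega)
  rw [Nat.add_sub_cancel (m + 2) 1, transferFactor_eq_binomialSum hb he hg,
    transferFactor_eq_binomialSum (fun j => hb (1 + j)) (fun j => he (1 + j))
      (fun j => hg (1 + j)), dtPart, dtPart, binomialSum_pascal hb hg (m + 1), sub_neg_eq_add] at h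
  exact h

/-- The operation in cosimplicial degree one, on arguments `dt ⊗ bⱼ + 1 ⊗ eⱼ + t ⊗ gⱼ`. -/
theorem topCoeff_transferSeq {e : ℕ → lvl A 1} (hb : ∀ j, b j ∈ bideg A 1 0)
    (he : ∀ j, e j ∈ bideg A 1 (q j)) (hg : ∀ j, g j ∈ bideg A 1 (q j)) {l : ℕ} (hl : 2 < l) :
    topCoeff A 1 (transferSeq (signOp A 1) (homotopyOp A 1) l (dtPart b + affinePart e g)) =
      ∑ j ∈ Finset.range l, ((-1 : k) ^ (l - 1) * ((-1 : k) ^ q j) ^ (l - 1 - j) *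
        ((l - 1).choose j : k) * (((bernoulli (l - 1) : ℚ) : k) / ((l - 1).factorial : k))) •
          (prodOmit l j b * g j) := by
  obtain ⟨m, rfl⟩ : ∃ m, l = m + 3 := ⟨l - 3, by omega⟩
  have h := topCoeff_eq_zero zero_lt_one (transferSeq_add_binomialSum_mem hb he hg m)
  rw [map_add, topCoeff_binomialSum (by omega), ← sub_eq_add_neg, sub_eq_zero] at h
  exact h

end DegreeOne

end CosimplicialCDGA

/-! ### The operations on the total complex -/

namespace CosimplicialCDGA

variable {k : Type u} [Field k] {A : CosimplicialObject (CDGA.{v} k)}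

theorem incl_eq_zero {p p' : ℕ} (h : p' ≠ p) (x : lvl A p) : incl A p x p' = 0 :=
  Pi.single_eq_of_ne h x

theorem incl_self (p : ℕ) (x : lvl A p) : incl A p x p = x := Pi.single_eq_same p x

theorem incl_zero (p : ℕ) : incl A p (0 : lvl A p) = 0 := Pi.single_zero p

theorem partialTilde_mem {q : ℕ} {c : lvl A 0} (hc : c ∈ bideg A 0 q) :
    partialTilde A c ∈ bideg A 1 q :=
  sub_mem (CDGA.Hom.map_mem (A.δ (0 : Fin 2)) hc) (CDGA.Hom.map_mem (A.δ (1 : Fin 2)) hc)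

theorem faceMap_topFace (x : lvl A 1) : faceMap (A := A) (topFace 1) x = x := by
  have h : SimplexCategory.Hom.mk (a := ⦋1⦌) (b := ⦋1⦌) (topFace 1).2.toOrderHom = 𝟙 ⦋1⦌ := rfl
  change CDGA.algHom (A.map _) x = x
  erw [h, A.map_id]
  rfl

theorem faceMap_vertexFace_zero (x : lvl A 0) :
    faceMap (A := A) (vertexFace (n := 1) 0) x = CDGA.algHom (A.δ (1 : Fin 2)) x := by
  have h : SimplexCategory.Hom.mk (a := ⦋0⦌) (b := ⦋1⦌) (vertexFace (n := 1) 0).2.toOrderHom =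
      SimplexCategory.δ 1 := by
    refine SimplexCategory.Hom.ext _ _ (OrderHom.ext _ _ (funext fun i => ?_))
    fin_cases i
    rfl
  exact congrArg (fun f => CDGA.algHom (A.map f) x) h

theorem faceMap_vertexFace_one (x : lvl A 0) :
    faceMap (A := A) (vertexFace (n := 1) 1) x = CDGA.algHom (A.δ (0 : Fin 2)) x := by
  have h : SimplexCategory.Hom.mk (a := ⦋0⦌) (b := ⦋1⦌) (vertexFace (n := 1) 1).2.toOrderHom =
      SimplexCategory.δ 0 := by
    refine SimplexCategory.Hom.ext _ _ (OrderHom.ext _ _ (funext fun i => ?_))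
    fin_cases i
    rfl
  exact congrArg (fun f => CDGA.algHom (A.map f) x) h

theorem bary_one_zero : bary k 1 0 = 1 - MvPolynomial.X 0 := by
  simp [bary]

theorem bary_one_one : bary k 1 1 = MvPolynomial.X 0 := rfl

theorem whitney_edge {n : ℕ} (s : Fin (1 + 1) → Fin (n + 1)) : whitney (k := k) s =
    ofPoly (bary k n (s 0)) * dPoly (bary k n (s 1)) +
      (-1 : k) • (ofPoly (bary k n (s 1)) * dPoly (bary k n (s 0))) := by
  rw [whitney, Fin.sum_univ_two]
  simp [List.ofFn_succ]

theorem whitney_topFace_one : whitney (k := k) (topFace 1).2 = dt k := by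
  have hd0 : dPoly (bary k 1 0) = (-1 : k) • dt k := by
    have h0 : bary k 1 0 = MvPolynomial.C 1 + (-1 : k) • MvPolynomial.X 0 := by
      rw [bary_one_zero, map_one, neg_one_smul, sub_eq_add_neg]
    rw [h0, dPoly_add, dPoly_C, zero_add, dPoly_smul]
    rfl
  have h : ofPoly (bary k 1 0) + ofPoly (bary k 1 1) = (1 : Om k 1) := by
    rw [← ofPoly_add, bary_one_zero, bary_one_one, sub_add_cancel]
    rfl
  refine (whitney_edge _).trans ?_
  change ofPoly (bary k 1 0) * dt k +
    (-1 : k) • (ofPoly (bary k 1 1) * dPoly (bary k 1 0)) = dt k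
  rw [hd0, mul_smul_comm, smul_smul, neg_one_mul, neg_neg, one_smul, ← add_mul, h, one_mul]

/-- The operations on cochains in `A^{1,•}` vanish if an argument does. -/
theorem totMul_incl_fin_eq_zero {l : ℕ} (i : Fin l) {b : Fin l → lvl A 1} (hb : b i = 0) :
    totMul A l (fun r => incl A 1 (b r)) = 0 := by
  funext p
  let a : ℕ → Cochain A := fun r => if h : r < l then incl A 1 (b ⟨r, h⟩) else 0
  have ha : (fun r => incl A 1 (b r)) = fun r : Fin l => a r := by
    funext r
    simp [a]
  rw [ha, totMul_apply l p a, transferSeq_eq_zero i.isLt, map_zero]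
  · rfl
  · rw [← congrFun ha i, hb, incl_zero, psi_zero, map_zero]

theorem prod_eraseIdx_eq_zero {l : ℕ} {b : Fin l → lvl A 1} {i j : Fin l} (hij : j ≠ i)
    (hj : b j = 0) : ((List.ofFn b).eraseIdx i.val).prod = 0 := by
  refine List.prod_eq_zero (List.mem_eraseIdx_iff_getElem.mpr ⟨j.val, by simp, ?_, by simpa⟩)
  exact fun h => hij (Fin.ext h)

variable [CharZero k]

theorem inclOp_psi_one (b : lvl A 1) (c : lvl A 0) :
    inclOp A 1 (psi A (incl A 1 b + incl A 0 c) 1) = formTmul A (dt k) b +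
      (formTmul A 1 (CDGA.algHom (A.δ (1 : Fin 2)) c) +
        formTmul A (ofPoly (bernoulliPoly k 1)) (partialTilde A c)) := by
  rw [inclOp_psi, sum_face_one, whitney_vertexFace, whitney_vertexFace, whitney_topFace_one]
  have h1 : (incl A 1 b + incl A 0 c) (topFace 1).1.val = b :=
    (congrArg₂ _ (incl_self 1 b) (incl_eq_zero one_ne_zero c)).trans (add_zero b)
  have h0 : (incl A 1 b + incl A 0 c) 0 = c :=
    (congrArg₂ _ (incl_eq_zero zero_ne_one b) (incl_self 0 c)).trans (zero_add c)
  have hv : ∀ i, (incl A 1 b + incl A 0 c) (vertexFace (n := 1) i).1.val = c := fun _ => h0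
  have e1 : faceMap (topFace 1) ((incl A 1 b + incl A 0 c) (topFace 1).1.val) = b := by
    rw [h1, faceMap_topFace]
  have e2 : faceMap (vertexFace (n := 1) 0) ((incl A 1 b + incl A 0 c) _) =
    CDGA.algHom (A.δ (1 : Fin 2)) c := by
    rw [hv, faceMap_vertexFace_zero]
  have e3 : faceMap (vertexFace (n := 1) 1) ((incl A 1 b + incl A 0 c) _) =
    CDGA.algHom (A.δ (0 : Fin 2)) c := by
    rw [hv, faceMap_vertexFace_one]
  rw [e1, e2, e3]
  have hb0 : ofPoly (bary k 1 0) = 1 - ofPoly (bernoulliPoly k 1) := by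
    rw [bernoulliPoly_one, bary_one_zero]
    exact TensorProduct.sub_tmul _ _ _
  have hb1 : ofPoly (bary k 1 1) = ofPoly (bernoulliPoly k 1) := by
    rw [bernoulliPoly_one]; rfl
  rw [hb0, hb1, partialTilde, formTmul_sub, sub_formTmul]
  abel

/-- The operations on sums of elements `bᵢ ∈ A^{1,0}` and elements
`cᵢ ∈ A^{0,•}`, whose degrees `qᵢ` may vary. -/
theorem totMul_incl_add_incl {l : ℕ} (hl : 2 < l) {b : ℕ → lvl A 1} (hb : ∀ j, b j ∈ bideg A 1 0)
    {c : ℕ → lvl A 0} {q : ℕ → ℕ} (hc : ∀ j, c j ∈ bideg A 0 (q j)) :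
    totMul A l (fun r : Fin l => incl A 1 (b r) + incl A 0 (c r)) =
      incl A 1 (∑ j ∈ Finset.range l, ((-1 : k) ^ (l - 1) * ((-1 : k) ^ q j) ^ (l - 1 - j) *
        ((l - 1).choose j : k) * (((bernoulli (l - 1) : ℚ) : k) / ((l - 1).factorial : k))) •
          (prodOmit l j b * partialTilde A (c j))) +
      totMul A l (fun r : Fin l => incl A 1 (b r)) := by
  have hone : ∀ c : ℕ → lvl A 0, (∀ j, c j ∈ bideg A 0 (q j)) →
      totMul A l (fun r : Fin l => incl A 1 (b r) + incl A 0 (c r)) 1 =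
      ∑ j ∈ Finset.range l, ((-1 : k) ^ (l - 1) * ((-1 : k) ^ q j) ^ (l - 1 - j) *
        ((l - 1).choose j : k) * (((bernoulli (l - 1) : ℚ) : k) / ((l - 1).factorial : k))) •
          (prodOmit l j b * partialTilde A (c j)) := fun c hc => by
    have h : (fun r => inclOp A 1 (psi A (incl A 1 (b r) + incl A 0 (c r)) 1)) =
        dtPart b + affinePart (fun j => CDGA.algHom (A.δ (1 : Fin 2)) (c j))
          fun j => partialTilde A (c j) := funext fun r => inclOp_psi_one _ _
    rw [totMul_apply l 1 fun r => incl A 1 (b r) + incl A 0 (c r), h]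
    exact topCoeff_transferSeq hb (fun j => CDGA.Hom.map_mem (A.δ (1 : Fin 2)) (hc j))
      (fun j => partialTilde_mem (hc j)) hl
  have hzero : totMul A l (fun r : Fin l => incl A 1 (b r)) 1 = 0 := by
    have := hone 0 fun j => zero_mem _
    simpa [incl_zero, partialTilde] using this
  funext p
  rw [Pi.add_apply]
  rcases lt_trichotomy p 1 with hp | rfl | hp
  · obtain rfl : p = 0 := by omega
    rw [incl_eq_zero zero_ne_one, zero_add, totMul_apply l 0 fun r => incl A 1 (b r),
      totMul_apply l 0 fun r => incl A 1 (b r) + incl A 0 (c r), homotopyOp_zero,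
      transferSeq_of_homotopy_eq_zero hl, transferSeq_of_homotopy_eq_zero hl]
  · rw [hone c hc, hzero, incl_self, add_zero]
  · rw [incl_eq_zero hp.ne', zero_add, totMul_apply l p fun r => incl A 1 (b r),
      totMul_apply l p fun r => incl A 1 (b r) + incl A 0 (c r), ← sub_eq_zero, ← map_sub]
    -- The elements `c j` change the kernel by forms of degree at most `1 < p`.
    have h1 : ∀ j, inclOp A p (psi A (incl A 1 (b j)) p) ∈ formFiltration A p 1 := fun j =>
      inclOp_psi_mem_formFiltration fun i hi => incl_eq_zero hi.ne' _
    have h0 : ∀ j, inclOp A p (psi A (incl A 0 (c j)) p) ∈ formFiltration A p 0 := fun j =>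
      inclOp_psi_mem_formFiltration fun i hi => incl_eq_zero hi.ne' _
    have h01 : ∀ j, inclOp A p (psi A (incl A 0 (c j)) p) ∈ formFiltration A p 1 := fun j =>
      inclOp_psi_mem_formFiltration fun i hi => incl_eq_zero (by omega) _
    refine topCoeff_eq_zero hp (transferSeq_mem_and_sub_mem mul_mem_formFiltration
      signOp_mem_formFiltration homotopyOp_mem_formFiltration l (fun j => ?_) h1 (fun j => ?_)).2
    · rw [psi_add, map_add]
      exact add_mem (h1 j) (h01 j)
    · rw [psi_add, map_add, add_sub_cancel_left]
      exact h0 j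

/-- The formula of `totMul_incl_add_incl` for finite families of arguments. -/
theorem totMul_incl_add_incl_fin {l : ℕ} (hl : 2 < l)
    {b : Fin l → lvl A 1} (hb : ∀ j, b j ∈ bideg A 1 0)
    {c : Fin l → lvl A 0} {q : Fin l → ℕ} (hc : ∀ j, c j ∈ bideg A 0 (q j)) :
    totMul A l (fun r => incl A 1 (b r) + incl A 0 (c r)) =
      ∑ j, incl A 1 (((-1 : k) ^ (l - 1) * ((-1 : k) ^ q j) ^ (l - 1 - j.val) *
        ((l - 1).choose j.val : k) *
          (((bernoulli (l - 1) : ℚ) : k) / ((l - 1).factorial : k))) •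
          (((List.ofFn b).eraseIdx j.val).prod * partialTilde A (c j))) +
      totMul A l (fun r => incl A 1 (b r)) := by
  have ext : ∀ {M : Type v} [Zero M] (f : Fin l → M), ∃ g : ℕ → M, (∀ j : Fin l, g j = f j) ∧
      ∀ j, l ≤ j → g j = 0 := fun f =>
    ⟨fun j => if h : j < l then f ⟨j, h⟩ else 0, fun j => by simp, fun j hj => by
      simp [Nat.not_lt.mpr hj]⟩
  obtain ⟨b', hb', hb0⟩ := ext b
  obtain ⟨c', hc', hc0⟩ := ext c
  let q' : ℕ → ℕ := fun j => if h : j < l then q ⟨j, h⟩ else 0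
  have hq' : ∀ j : Fin l, q' j = q j := fun j => by simp [q']
  have h := totMul_incl_add_incl hl (b := b') (c := c') (q := q') (fun j => ?_) (fun j => ?_)
  · simp only [hb', hc'] at h
    rw [h, Finset.sum_range, incl]
    congr 1
    refine (map_sum (AddMonoidHom.single (lvl A) 1) _ _).trans ?_
    refine Finset.sum_congr rfl fun j _ => ?_
    rw [hq', hc', prodOmit]
    simp only [hb']
    rfl
  · rcases lt_or_ge j l with hj | hj
    · exact (hb' ⟨j, hj⟩).symm ▸ hb ⟨j, hj⟩
    · rw [hb0 j hj]; exact zero_mem _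
  · rcases lt_or_ge j l with hj | hj
    · have := hc ⟨j, hj⟩
      rwa [← hc', ← hq'] at this
    · rw [hc0 j hj]; exact zero_mem _

end CosimplicialCDGA

end

theorem mainTheorem5 {k : Type u} [Field k] [CharZero k] (A : CosimplicialObject (CDGA.{v} k))
    (l : ℕ) (hl : 2 < l)
    (a : Fin l → CosimplicialCDGA.Cochain A) (ha : ∀ i, a i ∈ CosimplicialCDGA.totN A 1)
    (b : Fin l → CosimplicialCDGA.lvl A 1) (hb : ∀ i, b i ∈ CosimplicialCDGA.bideg A 1 0)
    (c : Fin l → CosimplicialCDGA.lvl A 0) (hc : ∀ i, c i ∈ CosimplicialCDGA.bideg A 0 1)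
    (habc : ∀ i, a i = CosimplicialCDGA.incl A 1 (b i) + CosimplicialCDGA.incl A 0 (c i)) :
    (CosimplicialCDGA.totMul A l a =
      (∑ i : Fin l, CosimplicialCDGA.incl A 1
        (((-1 : k) ^ (l - 1) * (-1 : k) ^ i.val * ((l - 1).choose i.val : k) *
            (((bernoulli' (l - 1) : ℚ) : k) / ((l - 1).factorial : k))) •
          (((List.ofFn b).eraseIdx i.val).prod * CosimplicialCDGA.partialTilde A (c i)))) +
      CosimplicialCDGA.totMul A l (fun i => CosimplicialCDGA.incl A 1 (b i))) ∧
    (∀ (i : Fin l) (x : CosimplicialCDGA.lvl A 0), x ∈ CosimplicialCDGA.bideg A 0 0 →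
      CosimplicialCDGA.totMul A l (Function.update a i (CosimplicialCDGA.incl A 0 x)) =
        CosimplicialCDGA.incl A 1
          (((-1 : k) ^ (l - 1) * ((l - 1).choose i.val : k) *
              (((bernoulli' (l - 1) : ℚ) : k) / ((l - 1).factorial : k))) •
            (((List.ofFn b).eraseIdx i.val).prod * CosimplicialCDGA.partialTilde A x))) ∧
    (∀ (S : Finset (Fin l)) (x : Fin l → CosimplicialCDGA.lvl A 0), 2 ≤ S.card →
      (∀ i ∈ S, x i ∈ CosimplicialCDGA.bideg A 0 0) →
      CosimplicialCDGA.totMul A l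
        (fun i => if i ∈ S then CosimplicialCDGA.incl A 0 (x i) else a i) = 0) := by
  have hB : ((bernoulli' (l - 1) : ℚ) : k) = ((bernoulli (l - 1) : ℚ) : k) := by
    rw [bernoulli_eq_bernoulli'_of_ne_one (by omega)]
  refine ⟨?_, fun i x hx => ?_, fun S x hS hx => ?_⟩
  · rw [funext habc, CosimplicialCDGA.totMul_incl_add_incl_fin hl hb (q := fun _ => 1) hc]
    congr 1
    refine Finset.sum_congr rfl fun i _ => ?_
    congr 2
    rw [hB, pow_one]
    rcases Nat.even_or_odd (l - 1) with hev | hodd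
    · have h : (-1 : k) ^ (l - 1 - i.val) = (-1 : k) ^ i.val := by
        rw [neg_one_pow_congr]
        rw [Nat.even_sub (by omega)]
        simp [hev]
      rw [h]
    · -- Odd Bernoulli numbers vanish, so that the two signs need not agree.
      rw [bernoulli_eq_zero_of_odd hodd (by omega)]
      simp
  · have harg : Function.update a i (CosimplicialCDGA.incl A 0 x) = fun j =>
        CosimplicialCDGA.incl A 1 (Function.update b i 0 j) +
          CosimplicialCDGA.incl A 0 (Function.update c i x j) := by
      funext j
      rcases eq_or_ne j i with rfl | hj
      · simp [CosimplicialCDGA.incl_zero]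
      · simp [hj, habc]
    rw [harg, CosimplicialCDGA.totMul_incl_add_incl_fin hl (q := Function.update (fun _ => 1) i 0)
      (fun j => ?_) (fun j => ?_)]
    · have h0 : CosimplicialCDGA.totMul A l (fun r : Fin l =>
          CosimplicialCDGA.incl A 1 (Function.update b i 0 r)) = 0 :=
        CosimplicialCDGA.totMul_incl_fin_eq_zero i (by simp)
      rw [h0, add_zero, Finset.sum_eq_single i]
      · have hL : (List.ofFn (Function.update b i 0)).eraseIdx i.val =
            (List.ofFn b).eraseIdx i.val := by
          have h := (List.nodup_finRange l).map_update (f := b) i 0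
          rw [if_pos (List.mem_finRange i), List.idxOf_finRange] at h
          rw [List.ofFn_eq_map, List.ofFn_eq_map, h, List.eraseIdx_set_eq]
        rw [hL, hB]
        simp
      · intro j _ hj
        rw [CosimplicialCDGA.prod_eraseIdx_eq_zero hj.symm (by simp), zero_mul, smul_zero,
          CosimplicialCDGA.incl_zero]
      · simp
    · rcases eq_or_ne j i with rfl | hj
      · simp
      · simpa [hj] using hb j
    · rcases eq_or_ne j i with rfl | hj
      · simpa using hx
      · simpa [hj] using hc j
  · -- Replacing an argument by `x i ∈ A^{0,0}` amounts to `b i = 0` and `c i = x i`.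
    have harg : (fun i => if i ∈ S then CosimplicialCDGA.incl A 0 (x i) else a i) = fun j =>
        CosimplicialCDGA.incl A 1 (if j ∈ S then 0 else b j) +
          CosimplicialCDGA.incl A 0 (if j ∈ S then x j else c j) := by
      funext j
      split_ifs with hj
      · simp [CosimplicialCDGA.incl_zero]
      · exact habc j
    obtain ⟨s, hs, t, ht, hst⟩ := Finset.one_lt_card.mp hS
    rw [harg, CosimplicialCDGA.totMul_incl_add_incl_fin hl (q := fun j => if j ∈ S then 0 else 1)
      (fun j => ?_) (fun j => ?_)]
    · rw [CosimplicialCDGA.totMul_incl_fin_eq_zero s (by simp [hs]), add_zero]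
      refine Finset.sum_eq_zero fun j _ => ?_
      -- At least one of the factors `b s = 0` and `b t = 0` is not omitted.
      have hprod : ((List.ofFn fun j => if j ∈ S then 0 else b j).eraseIdx j.val).prod = 0 := by
        rcases eq_or_ne s j with rfl | hsj
        · exact CosimplicialCDGA.prod_eraseIdx_eq_zero hst.symm (by simp [ht])
        · exact CosimplicialCDGA.prod_eraseIdx_eq_zero hsj (by simp [hs])
      rw [hprod, zero_mul, smul_zero, CosimplicialCDGA.incl_zero]
    · split_ifs
      exacts [zero_mem _, hb j]
    · split_ifs with hj
      exacts [hx j hj, hc j]
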